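/- Let $D=\{Z\in M_{2\times 2}(\mathbb C): ZZ^*<I_2\}$, where $A<B$ means that $B-A$ is positive definite, and let $dZ$ be Lebesgue measure on $M_{2\times2}(\mathbb C)\cong\mathbb C^4$. For real $\lambda>3$ let $v_\lambda$ be the probability measure on $D$ given by $$dv_\lambda(Z)=c_\lambda\det(I_2-ZZ^*)^{\lambda-4}\,dZ,\qquad c_\lambda=\frac{(\lambda-3)(\lambda-2)^2(\lambda-1)}{\pi^4}.$$ Let $\mathcal H^2_\lambda(D)$ be the weighted Bergman space, that is, the closed subspace of $L^2(D,v_\lambda)$ of holomorphic functions, and let $B_\lambda:L^2(D,v_\lambda)\to\mathcal H^2_\lambda(D)$ be the orthogonal projection (the Bergman projection). For $\varphi\in L^\infty(D)$ the Toeplitz operator $T^{(\lambda)}_\varphi$ on $\mathcal H^2_\lambda(D)$ is $T^{(\lambda)}_\varphi f=B_\lambda(\varphi f)$. The group $\mathrm U(2)\times\mathrm U(2)$ acts on $D$ by $(A,B)\cdot Z=AZB^{-1}$. Let $\mathbb T^2\subset\mathrm U(2)$ be the subgroup of diagonal matrices and $\mathbb T^4=\mathbb T^2\times\mathbb T^2$.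 For a subgroup $H\subseteq\mathrm U(2)\times\mathrm U(2)$ let $\mathcal A^H$ be the space of all $\varphi\in L^\infty(D)$ such that for every $h\in H$ one has $\varphi(hZ)=\varphi(Z)$ for almost every $Z\in D$, and let $\mathcal T^{(\lambda)}(\mathcal A^H)$ be the $C^*$-algebra of bounded operators on $\mathcal H^2_\lambda(D)$ generated by the operators $T^{(\lambda)}_\varphi$ with $\varphi\in\mathcal A^H$. **Theorem.** For every $\lambda>3$ the following hold. 1. The $C^*$-algebra $\mathcal T^{(\lambda)}(\mathcal A^{\mathrm U(2)\times\mathbb T^2})$ is commutative. 2. If $H$ is a connected subgroup with $\mathbb T^4\subseteq H\subseteq\mathrm U(2)\times\mathrm U(2)$ such that $\mathcal T^{(\lambda)}(\mathcal A^H)$ is commutative, then $H$ is one of $\mathrm U(2)\times\mathrm U(2)$, $\mathrm U(2)\times\mathbb T^2$ or $\mathbb T^2\times\mathrm U(2)$. 3. The $C^*$-algebras $\mathcal T^{(\lambda)}(\mathcal A^{\mathrm U(2)\times\mathbb T^2})$ and $\mathcal T^{(\lambda)}(\mathcal A^{\mathbb T^2\times\mathrm U(2)})$ are unitarily equivalent: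 there is a unitary operator $V$ on $\mathcal H^2_\lambda(D)$ with $V\,\mathcal T^{(\lambda)}(\mathcal A^{\mathrm U(2)\times\mathbb T^2})\,V^{*}=\mathcal T^{(\lambda)}(\mathcal A^{\mathbb T^2\times\mathrm U(2)})$. -/

import Mathlib

open MeasureTheory
open scoped ENNReal Matrix ComplexOrder

namespace MatrixBall

/-- The space of `2 × 2` complex matrices, as an array of entries (so that it carries the
standard Lebesgue measure `volume` of `ℂ⁴`). -/
abbrev MatSpace : Type := Fin 2 → Fin 2 → ℂ

/-- The matrix `I₂ - Z Z*`. -/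
noncomputable def gap (Z : MatSpace) : Matrix (Fin 2) (Fin 2) ℂ :=
  1 - Matrix.of Z * (Matrix.of Z)ᴴ

/-- The domain `D = {Z : Z Z* < I₂}`. -/
def domain : Set MatSpace := {Z | (gap Z).PosDef}

theorem continuous_gap : Continuous gap := by
  have h : Continuous fun Z : MatSpace => (Matrix.of Z : Matrix (Fin 2) (Fin 2) ℂ) := continuous_id
  exact continuous_const.sub (h.matrix_mul h.matrix_conjTranspose)

theorem gap_isHermitian (Z : MatSpace) : (gap Z).IsHermitian := by
  unfold gap
  exact Matrix.isHermitian_one.sub (Matrix.isHermitian_mul_conjTranspose_self _)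

theorem mem_domain_iff (Z : MatSpace) :
    Z ∈ domain ↔ ∀ x ∈ Metric.sphere (0 : Fin 2 → ℂ) 1, 0 < (star x ⬝ᵥ (gap Z *ᵥ x)).re := by
  constructor
  · intro h x hx
    have hx0 : x ≠ 0 := by rintro rfl; simp at hx
    have := (Matrix.posDef_iff_dotProduct_mulVec.1 h).2 hx0
    exact (Complex.lt_def.1 this).1
  · intro h
    refine Matrix.posDef_iff_dotProduct_mulVec.2 ⟨gap_isHermitian Z, fun x hx => ?_⟩
    have hn : ‖x‖ ≠ 0 := norm_ne_zero_iff.2 hx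
    have hs := h ((‖x‖⁻¹ : ℂ) • x) (by
      simp [norm_smul, hn])
    have him : (star x ⬝ᵥ (gap Z *ᵥ x)).im = 0 := (gap_isHermitian Z).im_star_dotProduct_mulVec_self x
    rw [Complex.lt_def]
    refine ⟨?_, him.symm⟩
    rw [Matrix.mulVec_smul, star_smul, smul_dotProduct, dotProduct_smul, smul_smul] at hs
    have h2 : star (‖x‖⁻¹ : ℂ) * (‖x‖⁻¹ : ℂ) = ((‖x‖⁻¹ * ‖x‖⁻¹ : ℝ) : ℂ) := by
      simp
    rw [h2, smul_eq_mul, Complex.re_ofReal_mul] at hs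
    exact (pos_iff_pos_of_mul_pos hs).1 (by positivity)

theorem isOpen_domain : IsOpen domain := by
  have : domain = {Z | ∀ x ∈ Metric.sphere (0 : Fin 2 → ℂ) 1,
      0 < (star x ⬝ᵥ (gap Z *ᵥ x)).re} := by
    ext Z; exact mem_domain_iff Z
  rw [this, isOpen_iff_eventually]
  intro Z hZ
  have hc : Continuous fun p : MatSpace × (Fin 2 → ℂ) => (star p.2 ⬝ᵥ (gap p.1 *ᵥ p.2)).re := by
    refine Complex.continuous_re.comp ?_
    exact (continuous_snd.star).dotProduct ((continuous_gap.comp continuous_fst).matrix_mulVec continuous_snd)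
  exact (isCompact_sphere (0 : Fin 2 → ℂ) 1).eventually_forall_of_forall_eventually
    fun x hx => (hc.tendsto (Z, x)).eventually (lt_mem_nhds (hZ x hx))

/-- `det (I₂ - Z Z*)`, a real number. -/
noncomputable def gapDet (Z : MatSpace) : ℝ := (gap Z).det.re

theorem continuous_gapDet : Continuous gapDet :=
  Complex.continuous_re.comp continuous_gap.matrix_det

theorem gapDet_pos {Z : MatSpace} (hZ : Z ∈ domain) : 0 < gapDet Z :=
  (Complex.lt_def.1 (Matrix.PosDef.det_pos hZ)).1

/-! ### Local estimates for holomorphic functions, for the completeness of the Bergman space -/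

theorem measurePreserving_unit_smul (a : Circle) :
    MeasurePreserving (fun W : MatSpace => (a : ℂ) • W) volume volume := by
  have h1 : MeasurePreserving (fun z : ℂ => (a : ℂ) * z) volume volume :=
    (rotation a).measurePreserving
  exact measurePreserving_pi _ _ fun _ => measurePreserving_pi _ _ fun _ => h1

theorem enorm_le_circle_lintegral {h : ℂ → ℂ} (hh : DiffContOnCl ℂ h (Metric.ball 0 1)) :
    ENNReal.ofReal (2 * Real.pi) * ‖h 0‖ₑ
      ≤ ∫⁻ t in Set.Ioc 0 (2 * Real.pi), ‖h (Circle.exp t)‖ₑ := by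
  have h0 : Real.circleAverage h 0 1 = h 0 := DiffContOnCl.circleAverage (by simpa using hh)
  rw [← h0, Real.circleAverage, intervalIntegral.integral_of_le Real.two_pi_pos.le, enorm_smul]
  have h2 : ENNReal.ofReal (2 * Real.pi) * ‖(2 * Real.pi)⁻¹‖ₑ = 1 := by
    rw [Real.enorm_of_nonneg (by positivity), ← ENNReal.ofReal_mul (by positivity),
      mul_inv_cancel₀ (by positivity), ENNReal.ofReal_one]
  rw [← mul_assoc, h2, one_mul]
  refine (enorm_integral_le_lintegral_enorm _).trans (le_of_eq ?_)
  refine lintegral_congr fun t => ?_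
  simp [circleMap, Circle.coe_exp]

/-- Sub-mean-value property of holomorphic functions over a ball. -/
theorem volume_mul_enorm_le {U : Set MatSpace} {g : MatSpace → ℂ} (hg : DifferentiableOn ℂ g U)
    {Z : MatSpace} {r : ℝ} (hr : Metric.ball Z r ⊆ U) :
    volume (Metric.ball (0 : MatSpace) r) * ‖g Z‖ₑ ≤ ∫⁻ W in Metric.ball Z r, ‖g W‖ₑ := by
  set B := Metric.ball (0 : MatSpace) r with hB
  have key : ∀ W ∈ B, ENNReal.ofReal (2 * Real.pi) * ‖g Z‖ₑ
      ≤ ∫⁻ t in Set.Ioc 0 (2 * Real.pi), ‖g (Z + (Circle.exp t : ℂ) • W)‖ₑ := by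
    intro W hW
    have hW' : ‖W‖ < r := by simpa [hB] using hW
    have hd : DiffContOnCl ℂ (fun ζ : ℂ => g (Z + ζ • W)) (Metric.ball 0 1) := by
      refine DifferentiableOn.diffContOnCl ?_
      rw [closure_ball _ one_ne_zero]
      refine hg.comp (by fun_prop) fun ζ hζ => hr ?_
      rw [mem_closedBall_zero_iff] at hζ
      rw [Metric.mem_ball, dist_eq_norm, add_sub_cancel_left, norm_smul]
      exact lt_of_le_of_lt (mul_le_of_le_one_left (norm_nonneg _) hζ) hW'
    simpa using enorm_le_circle_lintegral hd
  have hmap : ∀ (t : ℝ) (W : MatSpace), W ∈ B → Z + (Circle.exp t : ℂ) • W ∈ U := by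
    intro t W hW
    refine hr ?_
    rw [Metric.mem_ball, dist_eq_norm, add_sub_cancel_left, norm_smul]
    simpa [hB] using hW
  have hrot : ∀ t : ℝ, ∫⁻ W in B, ‖g (Z + (Circle.exp t : ℂ) • W)‖ₑ
      = ∫⁻ W in Metric.ball Z r, ‖g W‖ₑ := by
    intro t
    have hmp : MeasurePreserving (fun W : MatSpace => Z + (Circle.exp t : ℂ) • W) volume volume :=
      (measurePreserving_add_left volume Z).comp (measurePreserving_unit_smul (Circle.exp t))
    have hemb : MeasurableEmbedding (fun W : MatSpace => Z + (Circle.exp t : ℂ) • W) :=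
      (measurableEmbedding_addLeft Z).comp
        (measurableEmbedding_const_smul₀ (Circle.coe_ne_zero (Circle.exp t)))
    have hpre : (fun W : MatSpace => Z + (Circle.exp t : ℂ) • W) ⁻¹' Metric.ball Z r = B := by
      ext W
      rw [Set.mem_preimage, Metric.mem_ball, dist_eq_norm, add_sub_cancel_left, norm_smul]
      simp [hB]
    rw [← hmp.setLIntegral_comp_preimage_emb hemb (fun W => ‖g W‖ₑ) (Metric.ball Z r), hpre]
  have hmeas : AEMeasurable (Function.uncurry fun (W : MatSpace) (t : ℝ) =>
      ‖g (Z + (Circle.exp t : ℂ) • W)‖ₑ)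
      ((volume.restrict B).prod (volume.restrict (Set.Ioc 0 (2 * Real.pi)))) := by
    rw [Measure.prod_restrict]
    refine ContinuousOn.aemeasurable ?_ (Metric.isOpen_ball.measurableSet.prod measurableSet_Ioc)
    refine ContinuousOn.enorm (hg.continuousOn.comp ?_ ?_)
    · fun_prop
    · rintro ⟨W, t⟩ ⟨hW, -⟩
      exact hmap t W hW
  have h1 : ENNReal.ofReal (2 * Real.pi) * (volume B * ‖g Z‖ₑ)
      ≤ ENNReal.ofReal (2 * Real.pi) * ∫⁻ W in Metric.ball Z r, ‖g W‖ₑ := by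
    calc ENNReal.ofReal (2 * Real.pi) * (volume B * ‖g Z‖ₑ)
        = ∫⁻ _ in B, ENNReal.ofReal (2 * Real.pi) * ‖g Z‖ₑ := by
          rw [setLIntegral_const]; ring
      _ ≤ ∫⁻ W in B, ∫⁻ t in Set.Ioc 0 (2 * Real.pi), ‖g (Z + (Circle.exp t : ℂ) • W)‖ₑ :=
          setLIntegral_mono' Metric.isOpen_ball.measurableSet key
      _ = ∫⁻ t in Set.Ioc 0 (2 * Real.pi), ∫⁻ W in B, ‖g (Z + (Circle.exp t : ℂ) • W)‖ₑ :=
          lintegral_lintegral_swap hmeas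
      _ = _ := by
          simp_rw [hrot]
          rw [setLIntegral_const, Real.volume_Ioc, sub_zero, mul_comm]
  exact (ENNReal.mul_le_mul_iff_right (by simp [Real.pi_pos]) ENNReal.ofReal_ne_top).1 h1

/-- On small balls, the supremum of a holomorphic function is controlled by its weighted
`L²`-norm. -/
theorem exists_local_bound {U : Set MatSpace} (hU : IsOpen U) {w : MatSpace → ℝ}
    (hw : ContinuousOn w U) (hpos : ∀ Z ∈ U, 0 < w Z) {Z₀ : MatSpace} (hZ₀ : Z₀ ∈ U) :
    ∃ r : ℝ, 0 < r ∧ Metric.ball Z₀ r ⊆ U ∧ ∃ C : ℝ≥0∞, C ≠ ∞ ∧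
      ∀ g : MatSpace → ℂ, DifferentiableOn ℂ g U → ∀ Z ∈ Metric.ball Z₀ r, ‖g Z‖ₑ ≤
        C * eLpNorm g 2 ((volume.restrict U).withDensity fun Z => ENNReal.ofReal (w Z)) := by
  set μ := (volume.restrict U).withDensity fun Z => ENNReal.ofReal (w Z) with hμ
  obtain ⟨ε, hε, hεU⟩ := Metric.isOpen_iff.1 hU Z₀ hZ₀
  set r := ε / 4 with hr
  have hr0 : 0 < r := by positivity
  set K := Metric.closedBall Z₀ (2 * r) with hK
  have hKU : K ⊆ U := (Metric.closedBall_subset_ball (by rw [hr]; linarith)).trans hεU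
  have hKc : IsCompact K := isCompact_closedBall _ _
  have hKm : MeasurableSet K := hKc.isClosed.measurableSet
  obtain ⟨Zm, hZm, hmin⟩ := hKc.exists_isMinOn ⟨Z₀, Metric.mem_closedBall_self (by positivity)⟩
    (hw.mono hKU)
  set δ := ENNReal.ofReal (w Zm) with hδ
  have hδ0 : δ ≠ 0 := by simpa [hδ] using hpos Zm (hKU hZm)
  have hwm : AEMeasurable (fun Z => ENNReal.ofReal (w Z)) (volume.restrict U) :=
    (hw.aemeasurable hU.measurableSet).ennreal_ofReal
  have hμK : μ K ≠ ∞ := by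
    obtain ⟨ZM, hZM, hmax⟩ := hKc.exists_isMaxOn
      ⟨Z₀, Metric.mem_closedBall_self (by positivity)⟩ (hw.mono hKU)
    rw [hμ, withDensity_apply _ hKm, Measure.restrict_restrict hKm, Set.inter_eq_left.2 hKU]
    refine ne_top_of_le_ne_top (b := ENNReal.ofReal (w ZM) * volume K) ?_ ?_
    · exact ENNReal.mul_ne_top ENNReal.ofReal_ne_top hKc.measure_lt_top.ne
    · rw [← setLIntegral_const]
      exact setLIntegral_mono' hKm fun Z hZ => ENNReal.ofReal_le_ofReal (hmax hZ)
  set V := volume (Metric.ball (0 : MatSpace) r) with hV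
  have hV0 : V ≠ 0 := (Metric.measure_ball_pos volume _ hr0).ne'
  have hVt : V ≠ ∞ := Metric.isBounded_ball.measure_lt_top.ne
  refine ⟨r, hr0, (Metric.ball_subset_ball (by rw [hr]; linarith)).trans hεU,
    V⁻¹ * (δ⁻¹ * μ K ^ (1 / (1 : ℝ≥0∞).toReal - 1 / (2 : ℝ≥0∞).toReal)), ?_, ?_⟩
  · refine ENNReal.mul_ne_top (ENNReal.inv_ne_top.2 hV0)
      (ENNReal.mul_ne_top (ENNReal.inv_ne_top.2 hδ0) (ENNReal.rpow_ne_top_of_nonneg ?_ hμK))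
    norm_num
  intro g hg Z hZ
  have hZK : Metric.ball Z r ⊆ K := by
    intro W hW
    rw [Metric.mem_ball] at hZ hW
    rw [hK, Metric.mem_closedBall]
    linarith [dist_triangle W Z Z₀]
  have hgm : AEStronglyMeasurable g (volume.restrict U) :=
    hg.continuousOn.aestronglyMeasurable hU.measurableSet
  have hac : μ ≪ volume.restrict U := withDensity_absolutelyContinuous _ _
  have hb1 : V * ‖g Z‖ₑ ≤ ∫⁻ W in K, ‖g W‖ₑ :=
    (volume_mul_enorm_le hg (hZK.trans hKU)).trans (lintegral_mono_set hZK)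
  have hb2 : δ * ∫⁻ W in K, ‖g W‖ₑ ≤ ∫⁻ W in K, ‖g W‖ₑ ∂μ := by
    rw [hμ, restrict_withDensity hKm, Measure.restrict_restrict hKm, Set.inter_eq_left.2 hKU,
      lintegral_withDensity_eq_lintegral_mul₀ (hwm.mono_measure (Measure.restrict_mono hKU le_rfl))
        (hgm.mono_measure (Measure.restrict_mono hKU le_rfl)).enorm,
      ← lintegral_const_mul'' _ (hgm.mono_measure (Measure.restrict_mono hKU le_rfl)).enorm]
    exact setLIntegral_mono' hKm fun W hW =>
      mul_le_mul_left (ENNReal.ofReal_le_ofReal (hmin hW)) _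
  have hb3 : ∫⁻ W in K, ‖g W‖ₑ ∂μ ≤
      eLpNorm g 2 μ * μ K ^ (1 / (1 : ℝ≥0∞).toReal - 1 / (2 : ℝ≥0∞).toReal) := by
    have := eLpNorm_le_eLpNorm_mul_rpow_measure_univ (μ := μ.restrict K) (f := g)
      (p := 1) (q := 2) (by norm_num) (hgm.mono_ac hac).restrict
    rw [eLpNorm_one_eq_lintegral_enorm, Measure.restrict_apply_univ] at this
    exact this.trans (mul_le_mul_left (eLpNorm_restrict_le _ _ _ _) _)
  have hb4 : ∫⁻ W in K, ‖g W‖ₑ ≤ δ⁻¹ * (eLpNorm g 2 μ *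
      μ K ^ (1 / (1 : ℝ≥0∞).toReal - 1 / (2 : ℝ≥0∞).toReal)) := by
    rw [← ENNReal.mul_le_iff_le_inv hδ0 ENNReal.ofReal_ne_top]
    exact hb2.trans hb3
  calc ‖g Z‖ₑ ≤ V⁻¹ * (∫⁻ W in K, ‖g W‖ₑ) := by
        rw [← ENNReal.mul_le_iff_le_inv hV0 hVt]; exact hb1
    _ ≤ V⁻¹ * (δ⁻¹ * (eLpNorm g 2 μ *
      μ K ^ (1 / (1 : ℝ≥0∞).toReal - 1 / (2 : ℝ≥0∞).toReal))) := mul_le_mul_right hb4 _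
    _ = _ := by ring

/-- Cauchy estimate for the Fréchet derivative. -/
theorem norm_fderiv_le {h : MatSpace → ℂ} {Z : MatSpace} {ρ S : ℝ} (hρ : 0 < ρ)
    (hd : DifferentiableOn ℂ h (Metric.ball Z ρ)) (hS : ∀ W ∈ Metric.ball Z ρ, ‖h W‖ ≤ S) :
    ‖fderiv ℂ h Z‖ ≤ 2 * S / ρ := by
  have hS0 : 0 ≤ S := (norm_nonneg _).trans (hS Z (Metric.mem_ball_self hρ))
  refine ContinuousLinearMap.opNorm_le_bound _ (by positivity) fun v => ?_
  rcases eq_or_ne v 0 with rfl | hv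
  · simp
  have hv0 : 0 < ‖v‖ := norm_pos_iff.2 hv
  set R := ρ / (2 * ‖v‖) with hR
  have hR0 : 0 < R := by positivity
  have hmem : ∀ ζ ∈ Metric.closedBall (0 : ℂ) R, Z + ζ • v ∈ Metric.ball Z ρ := by
    intro ζ hζ
    rw [mem_closedBall_zero_iff] at hζ
    rw [Metric.mem_ball, dist_eq_norm, add_sub_cancel_left, norm_smul]
    calc ‖ζ‖ * ‖v‖ ≤ R * ‖v‖ := by gcongr
      _ = ρ / 2 := by rw [hR]; field_simp
      _ < ρ := by linarith
  have hdl : DiffContOnCl ℂ (fun ζ : ℂ => h (Z + ζ • v)) (Metric.ball 0 R) := by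
    refine DifferentiableOn.diffContOnCl ?_
    rw [closure_ball _ hR0.ne']
    exact hd.comp (by fun_prop) hmem
  have hle := Complex.norm_deriv_le_of_forall_mem_sphere_norm_le hR0 hdl fun ζ hζ =>
    hS _ (hmem ζ (Metric.sphere_subset_closedBall hζ))
  have hderiv : HasDerivAt (fun ζ : ℂ => h (Z + ζ • v)) (fderiv ℂ h Z v) 0 := by
    have h1 : HasFDerivAt h (fderiv ℂ h Z) (Z + (0 : ℂ) • v) := by
      rw [zero_smul, add_zero]
      exact (hd.differentiableAt (Metric.ball_mem_nhds Z hρ)).hasFDerivAt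
    have h2 : HasDerivAt (fun ζ : ℂ => Z + ζ • v) v 0 := by
      simpa using ((hasDerivAt_id (0 : ℂ)).smul_const v).const_add Z
    exact h1.comp_hasDerivAt (0 : ℂ) h2
  rw [hderiv.deriv] at hle
  refine hle.trans (le_of_eq ?_)
  rw [hR]; field_simp

/-- A sequence of holomorphic functions that is Cauchy in a weighted `L²`-norm converges pointwise
to a holomorphic function. -/
theorem exists_holomorphic_limit {U : Set MatSpace} (hU : IsOpen U) {w : MatSpace → ℝ}
    (hw : ContinuousOn w U) (hpos : ∀ Z ∈ U, 0 < w Z) {g : ℕ → MatSpace → ℂ}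
    (hg : ∀ n, DifferentiableOn ℂ (g n) U)
    (hc : ∀ ε : ℝ≥0∞, 0 < ε → ∃ N, ∀ n ≥ N, ∀ m ≥ N, eLpNorm (g n - g m) 2
      ((volume.restrict U).withDensity fun Z => ENNReal.ofReal (w Z)) ≤ ε) :
    ∃ G : MatSpace → ℂ, DifferentiableOn ℂ G U ∧
      ∀ Z ∈ U, Filter.Tendsto (fun n => g n Z) Filter.atTop (nhds (G Z)) := by
  have hloc : ∀ Z₀ ∈ U, ∃ r : ℝ, 0 < r ∧ Metric.ball Z₀ r ⊆ U ∧ ∀ ε : ℝ, 0 < ε → ∃ N, ∀ n ≥ N,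
      ∀ m ≥ N, ∀ Z ∈ Metric.ball Z₀ r, ‖g n Z - g m Z‖ ≤ ε := by
    intro Z₀ hZ₀
    obtain ⟨r, hr, hrU, C, hC, hb⟩ := exists_local_bound hU hw hpos hZ₀
    refine ⟨r, hr, hrU, fun ε hε => ?_⟩
    obtain ⟨N, hN⟩ := hc (ENNReal.ofReal ε / (C + 1))
      (ENNReal.div_pos (by simpa using hε) (by simp [hC]))
    refine ⟨N, fun n hn m hm Z hZ => ?_⟩
    have h1 := hb (g n - g m) ((hg n).sub (hg m)) Z hZ
    have h2 : ‖(g n - g m) Z‖ₑ ≤ ENNReal.ofReal ε := by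
      refine h1.trans ((mul_le_mul' (le_self_add (a := C) (b := 1)) (hN n hn m hm)).trans ?_)
      exact ENNReal.mul_div_le
    rw [← ofReal_norm, ENNReal.ofReal_le_ofReal_iff hε.le] at h2
    exact h2
  have hpt : ∀ Z ∈ U, ∃ l, Filter.Tendsto (fun n => g n Z) Filter.atTop (nhds l) := by
    intro Z hZ
    obtain ⟨r, hr, -, hN⟩ := hloc Z hZ
    refine cauchySeq_tendsto_of_complete (Metric.cauchySeq_iff.2 fun ε hε => ?_)
    obtain ⟨N, hN⟩ := hN (ε / 2) (by positivity)
    refine ⟨N, fun n hn m hm => ?_⟩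
    rw [dist_eq_norm]
    linarith [hN n hn m hm Z (Metric.mem_ball_self hr)]
  choose! G hG using hpt
  refine ⟨G, fun Z₀ hZ₀ => ?_, hG⟩
  obtain ⟨r, hr, hrU, hN⟩ := hloc Z₀ hZ₀
  have hsub : Metric.ball Z₀ (r / 2) ⊆ U := (Metric.ball_subset_ball (by linarith)).trans hrU
  have hat : ∀ n, ∀ Z ∈ U, DifferentiableAt ℂ (g n) Z := fun n Z hZ =>
    (hg n).differentiableAt (hU.mem_nhds hZ)
  have hcd : ∀ ε : ℝ, 0 < ε → ∃ N, ∀ n ≥ N, ∀ m ≥ N, ∀ Z ∈ Metric.ball Z₀ (r / 2),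
      ‖fderiv ℂ (g n) Z - fderiv ℂ (g m) Z‖ ≤ ε := by
    intro ε hε
    obtain ⟨N, hN⟩ := hN (ε * r / 4) (by positivity)
    refine ⟨N, fun n hn m hm Z hZ => ?_⟩
    have hb : Metric.ball Z (r / 2) ⊆ Metric.ball Z₀ r := by
      intro W hW
      rw [Metric.mem_ball] at hW hZ ⊢
      linarith [dist_triangle W Z Z₀]
    have := norm_fderiv_le (h := g n - g m) (half_pos hr)
      (((hg n).sub (hg m)).mono (hb.trans hrU)) fun W hW => hN n hn m hm W (hb hW)
    rw [fderiv_sub (hat n Z (hsub hZ)) (hat m Z (hsub hZ))] at this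
    refine this.trans (le_of_eq ?_)
    field_simp
    norm_num
  have hU' : UniformCauchySeqOn (fun n => fderiv ℂ (g n)) Filter.atTop
      (Metric.ball Z₀ (r / 2)) := by
    refine Metric.uniformCauchySeqOn_iff.2 fun ε hε => ?_
    obtain ⟨N, hN⟩ := hcd (ε / 2) (by positivity)
    refine ⟨N, fun n hn m hm Z hZ => ?_⟩
    rw [dist_eq_norm]
    linarith [hN n hn m hm Z hZ]
  have hlim : ∀ Z ∈ Metric.ball Z₀ (r / 2), ∃ l,
      Filter.Tendsto (fun n => fderiv ℂ (g n) Z) Filter.atTop (nhds l) := fun Z hZ =>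
    cauchySeq_tendsto_of_complete (hU'.cauchySeq hZ)
  choose! G' hG' using hlim
  have := hasFDerivAt_of_tendstoUniformlyOn Metric.isOpen_ball
    (hU'.tendstoUniformlyOn_of_tendsto hG')
    (fun n Z hZ => (hat n Z (hsub hZ)).hasFDerivAt) (fun Z hZ => hG Z (hsub hZ))
    (Metric.mem_ball_self (half_pos hr))
  exact this.differentiableAt.differentiableWithinAt

/-! ### Weighted Bergman spaces -/

/-- The normalizing constant `c_λ = (λ - 3)(λ - 2)²(λ - 1) / π⁴` of the weighted measure. -/
noncomputable def weightConst (lam : ℝ) : ℝ :=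
  (lam - 3) * (lam - 2) ^ 2 * (lam - 1) / Real.pi ^ 4

/-- The density `c_λ det (I₂ - Z Z*) ^ (λ - 4)`. -/
noncomputable def weight (lam : ℝ) (Z : MatSpace) : ℝ :=
  weightConst lam * gapDet Z ^ (lam - 4)

/-- The measure `v_λ` on `D` (a probability measure if `λ > 3`). -/
noncomputable def weightedMeasure (lam : ℝ) : Measure MatSpace :=
  (volume.restrict domain).withDensity fun Z => ENNReal.ofReal (weight lam Z)

theorem weightedMeasure_absolutelyContinuous (lam : ℝ) :
    weightedMeasure lam ≪ volume.restrict domain :=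
  withDensity_absolutelyContinuous _ _

theorem ae_mem_domain (lam : ℝ) : ∀ᵐ Z ∂(weightedMeasure lam), Z ∈ domain :=
  (weightedMeasure_absolutelyContinuous lam).ae_le (ae_restrict_mem isOpen_domain.measurableSet)

/-- The weighted Bergman space `H²_λ(D)` as a subspace of `L²(D, v_λ)`: the classes in `L²(D, v_λ)` that are represented by a
holomorphic function on `D`. -/
noncomputable def bergmanSubmodule (lam : ℝ) : Submodule ℂ (Lp ℂ 2 (weightedMeasure lam)) where
  carrier := {f | ∃ g : MatSpace → ℂ, DifferentiableOn ℂ g domain ∧ f =ᵐ[weightedMeasure lam] g}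
  add_mem' := by
    rintro f₁ f₂ ⟨g₁, hg₁, h₁⟩ ⟨g₂, hg₂, h₂⟩
    exact ⟨g₁ + g₂, hg₁.add hg₂, (Lp.coeFn_add f₁ f₂).trans (h₁.add h₂)⟩
  zero_mem' := ⟨0, differentiableOn_const 0, Lp.coeFn_zero ℂ 2 _⟩
  smul_mem' := by
    rintro c f ⟨g, hg, h⟩
    exact ⟨c • g, hg.const_smul c, (Lp.coeFn_smul c f).trans (h.const_smul c)⟩

theorem isClosed_bergmanSubmodule (lam : ℝ) :
    IsClosed (bergmanSubmodule lam : Set (Lp ℂ 2 (weightedMeasure lam))) := by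
  rcases le_or_gt (weightConst lam) 0 with hc | hc
  · have h0 : weightedMeasure lam = 0 := by
      unfold weightedMeasure
      rw [withDensity_eq_zero_iff]
      · filter_upwards [ae_restrict_mem isOpen_domain.measurableSet] with Z hZ
        exact ENNReal.ofReal_of_nonpos
          (mul_nonpos_of_nonpos_of_nonneg hc (Real.rpow_nonneg (gapDet_pos hZ).le _))
      · refine AEMeasurable.ennreal_ofReal ?_
        exact ((continuous_gapDet.measurable.pow_const _).const_mul _).aemeasurable
    have : bergmanSubmodule lam = ⊤ := by
      refine (Submodule.eq_top_iff').2 fun f => ⟨0, differentiableOn_const 0, ?_⟩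
      have hae : ∀ p : MatSpace → Prop, ∀ᵐ Z ∂(weightedMeasure lam), p Z := by
        rw [h0]; simp
      exact hae _
    rw [this]; exact isClosed_univ
  · have hpos : ∀ Z ∈ domain, 0 < weight lam Z := fun Z hZ =>
      mul_pos hc (Real.rpow_pos_of_pos (gapDet_pos hZ) _)
    have hw : ContinuousOn (weight lam) domain :=
      continuousOn_const.mul (continuous_gapDet.continuousOn.rpow_const
        fun Z hZ => Or.inl (gapDet_pos hZ).ne')
    refine IsSeqClosed.isClosed fun f F hf hF => ?_
    choose g hg hfg using hf
    obtain ⟨G, hG, hlim⟩ := exists_holomorphic_limit isOpen_domain hw hpos hg (by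
      intro ε hε
      obtain ⟨N, hN⟩ := EMetric.cauchySeq_iff.1 hF.cauchySeq ε hε
      refine ⟨N, fun n hn m hm => ?_⟩
      have h := (hN n hn m hm).le
      rw [Lp.edist_def] at h
      rwa [eLpNorm_congr_ae ((hfg n).sub (hfg m))] at h)
    refine ⟨G, hG, ?_⟩
    obtain ⟨φ, hφ, hae⟩ := (tendstoInMeasure_of_tendsto_Lp hF).exists_seq_tendsto_ae
    have hall : ∀ᵐ Z ∂(weightedMeasure lam), ∀ n, f n Z = g n Z := ae_all_iff.2 hfg
    filter_upwards [hae, hall, ae_mem_domain lam] with Z h1 h2 h3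
    refine tendsto_nhds_unique h1 ?_
    simp_rw [h2]
    exact (hlim Z h3).comp hφ.tendsto_atTop

/-- The weighted Bergman space `H²_λ(D)` as a Hilbert space, with the inner product of
`L²(D, v_λ)`. -/
def BergmanSpace (lam : ℝ) : Type := bergmanSubmodule lam

noncomputable instance (lam : ℝ) : NormedAddCommGroup (BergmanSpace lam) :=
  inferInstanceAs (NormedAddCommGroup (bergmanSubmodule lam))

noncomputable instance (lam : ℝ) : InnerProductSpace ℂ (BergmanSpace lam) :=
  inferInstanceAs (InnerProductSpace ℂ (bergmanSubmodule lam))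

instance completeSpace_bergmanSubmodule (lam : ℝ) : CompleteSpace (bergmanSubmodule lam) :=
  (isClosed_bergmanSubmodule lam).completeSpace_coe

instance (lam : ℝ) : CompleteSpace (BergmanSpace lam) :=
  completeSpace_bergmanSubmodule lam

/-- The inclusion of `H²_λ(D)` into `L²(D, v_λ)`. -/
noncomputable def inclusion (lam : ℝ) : BergmanSpace lam →L[ℂ] Lp ℂ 2 (weightedMeasure lam) :=
  (bergmanSubmodule lam).subtypeL

/-- The Bergman projection `B_λ`: the orthogonal projection of `L²(D, v_λ)` onto `H²_λ(D)`. -/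
noncomputable def bergmanProjection (lam : ℝ) :
    Lp ℂ 2 (weightedMeasure lam) →L[ℂ] BergmanSpace lam :=
  (bergmanSubmodule lam).orthogonalProjectionOnto

/-! ### Toeplitz operators -/

theorem memLp_weightedMeasure (lam : ℝ) {φ : MatSpace → ℂ}
    (hφ : MemLp φ ∞ (volume.restrict domain)) : MemLp φ ∞ (weightedMeasure lam) := by
  refine ⟨hφ.1.mono_ac (weightedMeasure_absolutelyContinuous lam), ?_⟩
  have h := hφ.2
  rw [eLpNorm_exponent_top] at h ⊢
  exact (eLpNormEssSup_mono_measure φ (weightedMeasure_absolutelyContinuous lam)).trans_lt h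

/-- Multiplication by an essentially bounded symbol, as an operator on `L²(D, v_λ)`. -/
noncomputable def mulOp (lam : ℝ) (φ : MatSpace → ℂ) (hφ : MemLp φ ∞ (volume.restrict domain)) :
    Lp ℂ 2 (weightedMeasure lam) →L[ℂ] Lp ℂ 2 (weightedMeasure lam) :=
  (ContinuousLinearMap.mul ℂ ℂ).holderL (weightedMeasure lam) ∞ 2 2
    ((memLp_weightedMeasure lam hφ).toLp φ)

theorem mulOp_apply_ae (lam : ℝ) (φ : MatSpace → ℂ) (hφ : MemLp φ ∞ (volume.restrict domain))
    (f : Lp ℂ 2 (weightedMeasure lam)) :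
    mulOp lam φ hφ f =ᵐ[weightedMeasure lam] fun Z => φ Z * f Z := by
  have h := (ContinuousLinearMap.mul ℂ ℂ).coeFn_holder (r := 2)
    ((memLp_weightedMeasure lam hφ).toLp φ) f
  filter_upwards [h, (memLp_weightedMeasure lam hφ).coeFn_toLp] with Z h1 h2
  simp only [mulOp, ContinuousLinearMap.holderL_apply_apply]
  rw [h1, h2]
  rfl

/-- The Toeplitz operator `T_φ f = B_λ (φ f)` on `H²_λ(D)`. -/
noncomputable def toeplitz (lam : ℝ) (φ : MatSpace → ℂ)
    (hφ : MemLp φ ∞ (volume.restrict domain)) : BergmanSpace lam →L[ℂ] BergmanSpace lam :=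
  bergmanProjection lam ∘L mulOp lam φ hφ ∘L inclusion lam

/-! ### Groups and invariant symbols -/

/-- The group `U(2)`, with the topology of `2 × 2` matrices. -/
abbrev U2 : Type := Matrix.unitaryGroup (Fin 2) ℂ

/-- The subgroup `𝕋²` of diagonal matrices in `U(2)`. -/
def diagTorus : Subgroup U2 where
  carrier := {A | (A : Matrix (Fin 2) (Fin 2) ℂ).IsDiag}
  mul_mem' := by
    intro A B hA hB i j hij
    have : ∀ k, (A : Matrix (Fin 2) (Fin 2) ℂ) i k * (B : Matrix (Fin 2) (Fin 2) ℂ) k j = 0 := by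
      intro k
      by_cases hk : i = k
      · rw [hB (hk ▸ hij), mul_zero]
      · rw [hA hk, zero_mul]
    simp [Matrix.mul_apply, this]
  one_mem' := Matrix.isDiag_one
  inv_mem' := by
    intro A hA
    exact Matrix.IsDiag.conjTranspose hA

/-- The action `(A, B) · Z = A Z B⁻¹` of `U(2) × U(2)` on matrices. -/
def act (h : U2 × U2) (Z : MatSpace) : MatSpace :=
  Matrix.of.symm ((h.1 : Matrix (Fin 2) (Fin 2) ℂ) * Matrix.of Z *
    ((h.2⁻¹ : U2) : Matrix (Fin 2) (Fin 2) ℂ))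

/-- The set `𝒜^H` of essentially bounded `H`-invariant symbols on `D`. -/
def invariantSymbols (H : Subgroup (U2 × U2)) : Set (MatSpace → ℂ) :=
  {φ | MemLp φ ∞ (volume.restrict domain) ∧
    ∀ h ∈ H, ∀ᵐ Z ∂(volume.restrict domain), φ (act h Z) = φ Z}

/-- The C*-algebra `𝒯^(λ)(𝒜^H)` of operators on `H²_λ(D)` generated by the Toeplitz operators with
symbols in `𝒜^H`: the norm closure of the *-algebra that they generate. (The constant symbol `1`
is invariant and gives the identity operator, so the unit may be included.) -/
noncomputable def toeplitzAlgebra (lam : ℝ) (H : Subgroup (U2 × U2)) :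
    StarSubalgebra ℂ (BergmanSpace lam →L[ℂ] BergmanSpace lam) :=
  (StarAlgebra.adjoin ℂ {T | ∃ φ, ∃ hφ : φ ∈ invariantSymbols H,
    T = toeplitz lam φ hφ.1}).topologicalClosure

/-- Commutativity of the C*-algebra `𝒯^(λ)(𝒜^H)`. -/
def IsCommutativeAlgebra (lam : ℝ) (H : Subgroup (U2 × U2)) : Prop :=
  ∀ S ∈ toeplitzAlgebra lam H, ∀ T ∈ toeplitzAlgebra lam H, S * T = T * S

/-- The torus `𝕋⁴` of pairs of diagonal matrices. -/
def torus4 : Subgroup (U2 × U2) := diagTorus.prod diagTorus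

/-- The subgroup `U(2) × 𝕋²`. -/
def unitaryTorus : Subgroup (U2 × U2) := (⊤ : Subgroup U2).prod diagTorus

/-- The subgroup `𝕋² × U(2)`. -/
def torusUnitary : Subgroup (U2 × U2) := diagTorus.prod (⊤ : Subgroup U2)

end MatrixBall

namespace MatrixBall

/-! ### Geometry of the domain -/

theorem gap_trace_re (Z : MatSpace) :
    (gap Z).trace.re = 2 - (Complex.normSq (Z 0 0) + Complex.normSq (Z 0 1) +
      Complex.normSq (Z 1 0) + Complex.normSq (Z 1 1)) := by
  simp [gap, Matrix.trace, Matrix.mul_apply, Fin.sum_univ_two, Complex.normSq_apply]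
  ring

theorem gapDet_eq (Z : MatSpace) :
    gapDet Z = 1 - (Complex.normSq (Z 0 0) + Complex.normSq (Z 0 1) +
      Complex.normSq (Z 1 0) + Complex.normSq (Z 1 1)) +
      Complex.normSq (Z 0 0 * Z 1 1 - Z 0 1 * Z 1 0) := by
  simp [gapDet, gap, Matrix.det_fin_two, Matrix.mul_apply, Fin.sum_univ_two, Complex.normSq_apply]
  ring

theorem mem_domain_iff_trace_gapDet (Z : MatSpace) :
    Z ∈ domain ↔ 0 < (gap Z).trace.re ∧ 0 < gapDet Z := by
  have hH := gap_isHermitian Z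
  have htr : (gap Z).trace.re = hH.eigenvalues 0 + hH.eigenvalues 1 := by
    rw [hH.trace_eq_sum_eigenvalues]; simp
  have hdet : gapDet Z = hH.eigenvalues 0 * hH.eigenvalues 1 := by
    rw [gapDet, hH.det_eq_prod_eigenvalues]; simp
  change (gap Z).PosDef ↔ _
  rw [hH.posDef_iff_eigenvalues_pos, htr, hdet]
  constructor
  · intro h
    exact ⟨add_pos (h 0) (h 1), mul_pos (h 0) (h 1)⟩
  · rintro ⟨h1, h2⟩ i
    have : 0 < hH.eigenvalues 0 ∧ 0 < hH.eigenvalues 1 := by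
      rcases pos_and_pos_or_neg_and_neg_of_mul_pos h2 with h | h
      · exact h
      · linarith [h.1, h.2]
    fin_cases i
    · exact this.1
    · exact this.2

theorem normSq_add_normSq_lt_one {Z : MatSpace} (hZ : Z ∈ domain) (i : Fin 2) :
    Complex.normSq (Z i 0) + Complex.normSq (Z i 1) < 1 := by
  have h := (Complex.lt_def.1 (Matrix.PosDef.diag_pos (i := i) hZ)).1
  simp [gap, Matrix.mul_apply, Fin.sum_univ_two] at h
  simp only [Complex.normSq_apply]
  linarith

/-- The transpose, as a linear map on the space of matrices. -/
def transposeEquiv : MatSpace ≃ₗ[ℂ] MatSpace where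
  toFun Z := fun i j => Z j i
  map_add' _ _ := rfl
  map_smul' _ _ := rfl
  invFun Z := fun i j => Z j i
  left_inv _ := rfl
  right_inv _ := rfl

/-- The entrywise conjugation. -/
def conjEquiv : MatSpace ≃ₗ[ℝ] MatSpace where
  toFun Z := star Z
  map_add' _ _ := star_add _ _
  map_smul' c Z := by ext i j; simp
  invFun Z := star Z
  left_inv _ := star_star _
  right_inv _ := star_star _

theorem act_apply (h : U2 × U2) (Z : MatSpace) : Matrix.of (act h Z) =
    (h.1 : Matrix (Fin 2) (Fin 2) ℂ) * Matrix.of Z * (h.2 : Matrix (Fin 2) (Fin 2) ℂ)ᴴ := rfl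

theorem act_mul (g h : U2 × U2) (Z : MatSpace) : act (g * h) Z = act g (act h Z) := by
  have : Matrix.of (act (g * h) Z) = Matrix.of (act g (act h Z)) := by
    simp only [act_apply, Prod.fst_mul, Prod.snd_mul, Submonoid.coe_mul,
      Matrix.conjTranspose_mul, Matrix.mul_assoc]
  exact this

theorem act_one (Z : MatSpace) : act 1 Z = Z := by
  have : Matrix.of (act 1 Z) = Matrix.of Z := by
    simp [act_apply]
  exact this

/-- The action of `U(2) × U(2)` by linear maps. -/
def actEquiv (h : U2 × U2) : MatSpace ≃ₗ[ℂ] MatSpace where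
  toFun := act h
  map_add' Z W := by
    have : Matrix.of (act h (Z + W)) = Matrix.of (act h Z) + Matrix.of (act h W) := by
      rw [act_apply, act_apply, act_apply, ← Matrix.add_mul, ← Matrix.mul_add]
      rfl
    exact this
  map_smul' c Z := by
    have : Matrix.of (act h (c • Z)) = c • Matrix.of (act h Z) := by
      rw [act_apply, act_apply, ← Matrix.smul_mul, ← Matrix.mul_smul]
      rfl
    exact this
  invFun := act h⁻¹
  left_inv Z := by rw [← act_mul, inv_mul_cancel, act_one]
  right_inv Z := by rw [← act_mul, mul_inv_cancel, act_one]

theorem gap_act (h : U2 × U2) (Z : MatSpace) :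
    gap (act h Z) = (h.1 : Matrix (Fin 2) (Fin 2) ℂ) * gap Z *
      star (h.1 : Matrix (Fin 2) (Fin 2) ℂ) := by
  have h1 : (h.1 : Matrix (Fin 2) (Fin 2) ℂ) * (h.1 : Matrix (Fin 2) (Fin 2) ℂ)ᴴ = 1 :=
    Matrix.mem_unitaryGroup_iff.1 h.1.2
  have h2 : (h.2 : Matrix (Fin 2) (Fin 2) ℂ)ᴴ * (h.2 : Matrix (Fin 2) (Fin 2) ℂ) = 1 :=
    Matrix.mem_unitaryGroup_iff'.1 h.2.2
  simp only [gap, act_apply, Matrix.conjTranspose_mul, Matrix.conjTranspose_conjTranspose,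
    Matrix.mul_sub, Matrix.sub_mul, Matrix.mul_one, Matrix.star_eq_conjTranspose, h1]
  congr 1
  simp only [Matrix.mul_assoc]
  rw [← Matrix.mul_assoc _ (h.2 : Matrix (Fin 2) (Fin 2) ℂ), h2, Matrix.one_mul]

/-- A map that preserves the domain and the function `det (1 - Z Z*)`. -/
structure IsDomainSymmetry (s : MatSpace → MatSpace) : Prop where
  mem_iff : ∀ Z, s Z ∈ domain ↔ Z ∈ domain
  gapDet_eq : ∀ Z, gapDet (s Z) = gapDet Z

theorem isDomainSymmetry_act (h : U2 × U2) : IsDomainSymmetry (actEquiv h) where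
  mem_iff Z := by
    change (gap (act h Z)).PosDef ↔ (gap Z).PosDef
    rw [gap_act]
    refine Matrix.IsUnit.posDef_star_right_conjugate_iff ?_
    exact (Unitary.toUnits h.1).isUnit
  gapDet_eq Z := by
    change (gap (act h Z)).det.re = (gap Z).det.re
    rw [gap_act, Matrix.det_mul_right_comm, Matrix.mem_unitaryGroup_iff.1 h.1.2, Matrix.one_mul]

theorem isDomainSymmetry_of_normSq {s : MatSpace → MatSpace}
    (h1 : ∀ Z, (gap (s Z)).trace.re = (gap Z).trace.re) (h2 : ∀ Z, gapDet (s Z) = gapDet Z) :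
    IsDomainSymmetry s where
  mem_iff Z := by rw [mem_domain_iff_trace_gapDet, mem_domain_iff_trace_gapDet, h1, h2]
  gapDet_eq := h2

theorem isDomainSymmetry_transpose : IsDomainSymmetry transposeEquiv := by
  refine isDomainSymmetry_of_normSq (fun Z => ?_) fun Z => ?_
  · simp only [gap_trace_re, transposeEquiv, LinearEquiv.coe_mk, LinearMap.coe_mk, AddHom.coe_mk]
    ring
  · simp only [gapDet_eq, transposeEquiv, LinearEquiv.coe_mk, LinearMap.coe_mk, AddHom.coe_mk,
      mul_comm (Z 1 0)]
    ring

theorem isDomainSymmetry_conj : IsDomainSymmetry conjEquiv := by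
  refine isDomainSymmetry_of_normSq (fun Z => ?_) fun Z => ?_
  · simp [gap_trace_re, conjEquiv, Complex.normSq_conj]
  · simp only [gapDet_eq, conjEquiv, LinearEquiv.coe_mk, LinearMap.coe_mk, AddHom.coe_mk,
      Pi.star_apply, RCLike.star_def, Complex.normSq_conj, ← map_mul, ← map_sub]

theorem zero_mem_domain : (0 : MatSpace) ∈ domain := by
  rw [mem_domain_iff_trace_gapDet, gap_trace_re, gapDet_eq]
  simp

theorem convex_domain : Convex ℝ domain := by
  intro Z hZ W hW a b ha hb hab
  have key : gap (a • Z + b • W) = a • gap Z + b • gap W +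
      (a * b) • (Matrix.of (Z - W) * (Matrix.of (Z - W))ᴴ) := by
    have hb' : b = 1 - a := by linarith
    subst hb'
    ext i j
    simp [gap, Matrix.mul_apply, Fin.sum_univ_two]
    ring
  change (gap _).PosDef
  rw [key]
  refine Matrix.PosDef.add_posSemidef ?_
    ((Matrix.posSemidef_self_mul_conjTranspose _).smul (mul_nonneg ha hb))
  rcases ha.eq_or_lt with rfl | ha
  · have : b = 1 := by linarith
    subst this
    rw [zero_smul, one_smul, zero_add]
    exact hW
  · exact (Matrix.PosDef.smul hZ ha).add_posSemidef ((Matrix.PosDef.posSemidef hW).smul hb)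

theorem norm_apply_lt_one {Z : MatSpace} (hZ : Z ∈ domain) (i j : Fin 2) : ‖Z i j‖ < 1 := by
  have h := normSq_add_normSq_lt_one hZ i
  have h0 := Complex.normSq_nonneg (Z i 0)
  have h1 := Complex.normSq_nonneg (Z i 1)
  have h2 : ‖Z i j‖ ^ 2 < 1 := by
    rw [← Complex.normSq_eq_norm_sq]
    fin_cases j
    · change Complex.normSq (Z i 0) < 1
      linarith
    · change Complex.normSq (Z i 1) < 1
      linarith
  nlinarith [norm_nonneg (Z i j)]

theorem domain_subset_ball : domain ⊆ Metric.ball (0 : MatSpace) 1 := by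
  intro Z hZ
  rw [mem_ball_zero_iff, pi_norm_lt_iff one_pos]
  intro i
  rw [pi_norm_lt_iff one_pos]
  exact norm_apply_lt_one hZ i

theorem volume_domain_ne_top : volume domain ≠ ∞ :=
  ((measure_mono domain_subset_ball).trans_lt Metric.isBounded_ball.measure_lt_top).ne

instance isAddHaarMeasure_volume : (volume : Measure MatSpace).IsAddHaarMeasure := by
  have : ∀ _ : Fin 2, (volume : Measure (Fin 2 → ℂ)).IsAddHaarMeasure := fun _ => inferInstance
  exact Measure.pi.isAddHaarMeasure (fun _ : Fin 2 => (volume : Measure (Fin 2 → ℂ)))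

theorem volume_domain_ne_zero : volume domain ≠ 0 :=
  (isOpen_domain.measure_pos volume ⟨0, zero_mem_domain⟩).ne'

/-! ### Invariance of the measures -/

theorem IsDomainSymmetry.preimage {s : MatSpace → MatSpace} (h : IsDomainSymmetry s) :
    s ⁻¹' domain = domain := Set.ext h.mem_iff

theorem IsDomainSymmetry.measurePreserving_volume {s : MatSpace ≃ₗ[ℝ] MatSpace}
    (h : IsDomainSymmetry s) : MeasurePreserving s volume volume := by
  have hc : Continuous s := s.toLinearMap.continuous_of_finiteDimensional
  refine ⟨hc.measurable, ?_⟩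
  have hmap := Measure.map_linearMap_addHaar_eq_smul_addHaar (volume : Measure MatSpace)
    (f := s.toLinearMap) s.isUnit_det'.ne_zero
  have h1 := congrArg (fun μ => μ domain) hmap
  simp only [LinearEquiv.coe_coe] at h1
  rw [Measure.map_apply hc.measurable isOpen_domain.measurableSet, h.preimage,
    Measure.smul_apply, smul_eq_mul] at h1
  have h2 : ENNReal.ofReal |(LinearMap.det s.toLinearMap)⁻¹| = 1 := by
    have := (ENNReal.mul_eq_right volume_domain_ne_zero volume_domain_ne_top).1 h1.symm
    exact this
  have hmap' : Measure.map s volume = _ := hmap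
  rw [hmap', h2, one_smul]

theorem IsDomainSymmetry.measurePreserving_restrict {s : MatSpace ≃ₗ[ℝ] MatSpace}
    (h : IsDomainSymmetry s) :
    MeasurePreserving s (volume.restrict domain) (volume.restrict domain) := by
  have := h.measurePreserving_volume.restrict_preimage isOpen_domain.measurableSet
  rwa [h.preimage] at this

theorem measurable_weight (lam : ℝ) : Measurable (weight lam) :=
  (continuous_gapDet.measurable.pow_const _).const_mul _

theorem IsDomainSymmetry.measurePreserving {s : MatSpace ≃ₗ[ℝ] MatSpace}
    (h : IsDomainSymmetry s) (lam : ℝ) :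
    MeasurePreserving s (weightedMeasure lam) (weightedMeasure lam) := by
  have hr := h.measurePreserving_restrict
  refine ⟨hr.measurable, ?_⟩
  ext A hA
  have hwm : Measurable fun Z => ENNReal.ofReal (weight lam Z) :=
    (measurable_weight lam).ennreal_ofReal
  rw [Measure.map_apply hr.measurable hA, weightedMeasure, withDensity_apply _ hA,
    withDensity_apply _ (hr.measurable hA), ← hr.setLIntegral_comp_preimage hA hwm]
  refine lintegral_congr fun Z => ?_
  simp only [weight, h.gapDet_eq]

/-! ### Holomorphic representatives and the reproducing kernel -/

section
variable {lam : ℝ}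

theorem weight_pos (hlam : 3 < lam) {Z : MatSpace} (hZ : Z ∈ domain) : 0 < weight lam Z := by
  have h1 : 0 < lam - 3 := by linarith
  have h2 : 0 < lam - 2 := by linarith
  have h3 : 0 < lam - 1 := by linarith
  have := Real.rpow_pos_of_pos (gapDet_pos hZ) (lam - 4)
  unfold weight weightConst
  positivity

theorem restrict_absolutelyContinuous (hlam : 3 < lam) :
    volume.restrict domain ≪ weightedMeasure lam := by
  refine withDensity_absolutelyContinuous' (measurable_weight lam).ennreal_ofReal.aemeasurable ?_
  filter_upwards [ae_restrict_mem isOpen_domain.measurableSet] with Z hZ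
  simpa using weight_pos hlam hZ

theorem eqOn_of_ae_eq (hlam : 3 < lam) {E : Type*} [TopologicalSpace E] [T2Space E]
    {f g : MatSpace → E}
    (hf : ContinuousOn f domain) (hg : ContinuousOn g domain)
    (h : f =ᵐ[weightedMeasure lam] g) : Set.EqOn f g domain :=
  Measure.eqOn_open_of_ae_eq ((restrict_absolutelyContinuous hlam).ae_le h) isOpen_domain hf hg

/-- The holomorphic function that represents an element of the Bergman space. -/
noncomputable def rep (u : BergmanSpace lam) : MatSpace → ℂ :=
  Classical.choose (show ∃ g : MatSpace → ℂ, DifferentiableOn ℂ g domain ∧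
    inclusion lam u =ᵐ[weightedMeasure lam] g from Subtype.prop (p := (· ∈ bergmanSubmodule lam)) u)

theorem differentiableOn_rep (u : BergmanSpace lam) : DifferentiableOn ℂ (rep u) domain :=
  (Classical.choose_spec (show ∃ g : MatSpace → ℂ, DifferentiableOn ℂ g domain ∧
    inclusion lam u =ᵐ[weightedMeasure lam] g
      from Subtype.prop (p := (· ∈ bergmanSubmodule lam)) u)).1

theorem inclusion_ae_eq (u : BergmanSpace lam) : inclusion lam u =ᵐ[weightedMeasure lam] rep u :=
  (Classical.choose_spec (show ∃ g : MatSpace → ℂ, DifferentiableOn ℂ g domain ∧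
    inclusion lam u =ᵐ[weightedMeasure lam] g
      from Subtype.prop (p := (· ∈ bergmanSubmodule lam)) u)).2

theorem memLp_rep (u : BergmanSpace lam) : MemLp (rep u) 2 (weightedMeasure lam) :=
  (memLp_congr_ae (inclusion_ae_eq u)).1 (Lp.memLp _)

theorem inclusion_injective : Function.Injective (inclusion lam) := Subtype.val_injective

theorem eqOn_rep (hlam : 3 < lam) {u : BergmanSpace lam} {g : MatSpace → ℂ}
    (hg : ContinuousOn g domain) (h : inclusion lam u =ᵐ[weightedMeasure lam] g) :
    Set.EqOn (rep u) g domain :=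
  eqOn_of_ae_eq hlam (differentiableOn_rep u).continuousOn hg ((inclusion_ae_eq u).symm.trans h)

theorem ext_rep {u w : BergmanSpace lam} (h : Set.EqOn (rep u) (rep w) domain) : u = w := by
  refine inclusion_injective (Lp.ext ?_)
  filter_upwards [inclusion_ae_eq u, inclusion_ae_eq w, ae_mem_domain lam] with Z h1 h2 h3
  rw [h1, h2, h h3]

theorem rep_add (hlam : 3 < lam) (u w : BergmanSpace lam) :
    Set.EqOn (rep (u + w)) (rep u + rep w) domain := by
  refine eqOn_rep hlam ((differentiableOn_rep u).add (differentiableOn_rep w)).continuousOn ?_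
  rw [map_add]
  exact (Lp.coeFn_add _ _).trans ((inclusion_ae_eq u).add (inclusion_ae_eq w))

theorem rep_smul (hlam : 3 < lam) (c : ℂ) (u : BergmanSpace lam) :
    Set.EqOn (rep (c • u)) (c • rep u) domain := by
  refine eqOn_rep hlam ((differentiableOn_rep u).const_smul c).continuousOn ?_
  rw [map_smul]
  exact (Lp.coeFn_smul _ _).trans ((inclusion_ae_eq u).const_smul c)

theorem exists_eqOn_rep (hlam : 3 < lam) {g : MatSpace → ℂ} (hg : DifferentiableOn ℂ g domain)
    (hL : MemLp g 2 (weightedMeasure lam)) :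
    ∃ u : BergmanSpace lam, Set.EqOn (rep u) g domain := by
  refine ⟨(⟨hL.toLp g, g, hg, hL.coeFn_toLp⟩ : bergmanSubmodule lam), ?_⟩
  exact eqOn_rep hlam hg.continuousOn hL.coeFn_toLp

theorem inner_eq_integral (u w : BergmanSpace lam) :
    inner ℂ u w = ∫ Z, star (rep u Z) * rep w Z ∂(weightedMeasure lam) := by
  have h : inner ℂ u w = inner ℂ (inclusion lam u) (inclusion lam w) := rfl
  rw [h, L2.inner_def]
  refine integral_congr_ae ?_
  filter_upwards [inclusion_ae_eq u, inclusion_ae_eq w] with Z h1 h2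
  rw [h1, h2, RCLike.inner_apply, mul_comm]
  rfl

theorem inner_toeplitz (u w : BergmanSpace lam) (φ : MatSpace → ℂ)
    (hφ : MemLp φ ∞ (volume.restrict domain)) :
    inner ℂ u (toeplitz lam φ hφ w) =
      ∫ Z, star (rep u Z) * (φ Z * rep w Z) ∂(weightedMeasure lam) := by
  have h : inner ℂ u (toeplitz lam φ hφ w) =
      inner ℂ (inclusion lam u) (mulOp lam φ hφ (inclusion lam w)) :=
    Submodule.inner_orthogonalProjectionOnto_eq_of_mem_left (K := bergmanSubmodule lam) u _
  rw [h, L2.inner_def]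
  refine integral_congr_ae ?_
  filter_upwards [inclusion_ae_eq u, inclusion_ae_eq w,
    mulOp_apply_ae lam φ hφ (inclusion lam w)] with Z h1 h2 h3
  rw [h1, h3, h2, RCLike.inner_apply, mul_comm]
  rfl

theorem exists_norm_rep_le (hlam : 3 < lam) {Z₀ : MatSpace} (hZ₀ : Z₀ ∈ domain) :
    ∃ r : ℝ, 0 < r ∧ ∃ C : ℝ, 0 ≤ C ∧ ∀ Z ∈ Metric.ball Z₀ r, ∀ u : BergmanSpace lam,
      ‖rep u Z‖ ≤ C * ‖u‖ := by
  have hw : ContinuousOn (weight lam) domain :=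
    continuousOn_const.mul (continuous_gapDet.continuousOn.rpow_const
      fun Z hZ => Or.inl (gapDet_pos hZ).ne')
  obtain ⟨r, hr, -, C, hC, hb⟩ := exists_local_bound isOpen_domain hw
    (fun Z hZ => weight_pos hlam hZ) hZ₀
  refine ⟨r, hr, C.toReal, ENNReal.toReal_nonneg, fun Z hZ u => ?_⟩
  have h1 := hb (rep u) (differentiableOn_rep u) Z hZ
  have h2 : eLpNorm (rep u) 2 (weightedMeasure lam) = ENNReal.ofReal ‖u‖ := by
    have h3 : ‖u‖ = ‖inclusion lam u‖ := rfl
    rw [h3, Lp.norm_def, ENNReal.ofReal_toReal (Lp.eLpNorm_ne_top _)]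
    exact eLpNorm_congr_ae (inclusion_ae_eq u).symm
  have h4 : ‖rep u Z‖ₑ ≤ C * ENNReal.ofReal ‖u‖ := by
    rw [← h2]; exact h1
  rw [← ENNReal.ofReal_toReal hC, ← ENNReal.ofReal_mul ENNReal.toReal_nonneg, ← ofReal_norm,
    ENNReal.ofReal_le_ofReal_iff (by positivity)] at h4
  exact h4

open Classical in
/-- The reproducing kernel of the Bergman space. -/
noncomputable def kernel (lam : ℝ) (Z : MatSpace) : BergmanSpace lam :=
  if h : ∃ k : BergmanSpace lam, ∀ u, inner ℂ k u = rep u Z then Classical.choose h else 0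

theorem inner_kernel (hlam : 3 < lam) {Z : MatSpace} (hZ : Z ∈ domain) (u : BergmanSpace lam) :
    inner ℂ (kernel lam Z) u = rep u Z := by
  have h : ∃ k : BergmanSpace lam, ∀ u, inner ℂ k u = rep u Z := by
    obtain ⟨r, hr, C, hC0, hC⟩ := exists_norm_rep_le hlam hZ
    let e : BergmanSpace lam →L[ℂ] ℂ := LinearMap.mkContinuous
      { toFun := fun u => rep u Z
        map_add' := fun u w => rep_add hlam u w hZ
        map_smul' := fun c u => rep_smul hlam c u hZ } C (hC Z (Metric.mem_ball_self hr))
    refine ⟨(InnerProductSpace.toDual ℂ _).symm e, fun u => ?_⟩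
    rw [InnerProductSpace.toDual_symm_apply]
    rfl
  rw [kernel, dif_pos h]
  exact Classical.choose_spec h u

theorem eq_of_inner_kernel (hlam : 3 < lam) {S T : BergmanSpace lam →L[ℂ] BergmanSpace lam}
    (h : ∀ Z ∈ domain, ∀ W ∈ domain,
      inner ℂ (kernel lam Z) (S (kernel lam W)) = inner ℂ (kernel lam Z) (T (kernel lam W))) :
    S = T := by
  have h1 : ∀ W ∈ domain, S (kernel lam W) = T (kernel lam W) := fun W hW =>
    ext_rep fun Z hZ => by rw [← inner_kernel hlam hZ, ← inner_kernel hlam hZ, h Z hZ W hW]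
  rw [← ContinuousLinearMap.adjoint.injective.eq_iff]
  ext u
  refine ext_rep fun W hW => ?_
  rw [← inner_kernel hlam hW, ← inner_kernel hlam hW, ContinuousLinearMap.adjoint_inner_right,
    ContinuousLinearMap.adjoint_inner_right, h1 W hW]

theorem exists_norm_kernel_le (hlam : 3 < lam) {Z₀ : MatSpace} (hZ₀ : Z₀ ∈ domain) :
    ∃ r : ℝ, 0 < r ∧ ∃ C : ℝ, ∀ Z ∈ Metric.ball Z₀ r, Z ∈ domain ∧ ‖kernel lam Z‖ ≤ C := by
  obtain ⟨r, hr, C, hC0, hC⟩ := exists_norm_rep_le hlam hZ₀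
  obtain ⟨ρ, hρ, hρD⟩ := Metric.isOpen_iff.1 isOpen_domain Z₀ hZ₀
  refine ⟨min r ρ, lt_min hr hρ, C, fun Z hZ => ?_⟩
  have hZD : Z ∈ domain := hρD (Metric.ball_subset_ball (min_le_right _ _) hZ)
  refine ⟨hZD, ?_⟩
  have h := hC Z (Metric.ball_subset_ball (min_le_left _ _) hZ) (kernel lam Z)
  rw [← inner_kernel hlam hZD, inner_self_eq_norm_sq_to_K] at h
  rcases (norm_nonneg (kernel lam Z)).eq_or_lt with h0 | h0
  · rwa [← h0]
  · simp only [Complex.coe_algebraMap, norm_pow, Complex.norm_real, norm_norm] at h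
    nlinarith

/-! ### Composition operators -/

theorem IsDomainSymmetry.symm {s : MatSpace ≃ₗ[ℂ] MatSpace} (h : IsDomainSymmetry s) :
    IsDomainSymmetry s.symm where
  mem_iff Z := by rw [← h.mem_iff, s.apply_symm_apply]
  gapDet_eq Z := by rw [← h.gapDet_eq, s.apply_symm_apply]

theorem IsDomainSymmetry.measurePreserving_complex {s : MatSpace ≃ₗ[ℂ] MatSpace}
    (h : IsDomainSymmetry s) (lam : ℝ) :
    MeasurePreserving s (weightedMeasure lam) (weightedMeasure lam) :=
  IsDomainSymmetry.measurePreserving (s := s.restrictScalars ℝ) h lam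

theorem IsDomainSymmetry.integral_comp {s : MatSpace ≃ₗ[ℝ] MatSpace}
    (h : IsDomainSymmetry s) (lam : ℝ) (f : MatSpace → ℂ) :
    ∫ Z, f (s Z) ∂(weightedMeasure lam) = ∫ Z, f Z ∂(weightedMeasure lam) :=
  (h.measurePreserving lam).integral_comp
    s.toContinuousLinearEquiv.toHomeomorph.measurableEmbedding f

theorem IsDomainSymmetry.differentiableOn_comp {s : MatSpace ≃ₗ[ℂ] MatSpace}
    (h : IsDomainSymmetry s) {g : MatSpace → ℂ} (hg : DifferentiableOn ℂ g domain) :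
    DifferentiableOn ℂ (g ∘ s) domain :=
  hg.comp s.toContinuousLinearEquiv.differentiable.differentiableOn fun Z hZ => (h.mem_iff Z).2 hZ

/-- Composition with a symmetry, as an isometry of the Bergman space. -/
noncomputable def compIsometry {s : MatSpace ≃ₗ[ℂ] MatSpace} (h : IsDomainSymmetry s) (lam : ℝ) :
    BergmanSpace lam →ₗᵢ[ℂ] BergmanSpace lam where
  toFun u := (⟨Lp.compMeasurePreservingₗᵢ ℂ s (h.measurePreserving_complex lam) (inclusion lam u),
    rep u ∘ s, h.differentiableOn_comp (differentiableOn_rep u),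
    (Lp.coeFn_compMeasurePreserving _ _).trans
      ((h.measurePreserving_complex lam).quasiMeasurePreserving.ae_eq_comp (inclusion_ae_eq u))⟩ :
    bergmanSubmodule lam)
  map_add' u w := by
    refine inclusion_injective ?_
    exact (Lp.compMeasurePreservingₗᵢ ℂ s (h.measurePreserving_complex lam)).map_add
      (inclusion lam u) (inclusion lam w)
  map_smul' c u := by
    refine inclusion_injective ?_
    exact (Lp.compMeasurePreservingₗᵢ ℂ s (h.measurePreserving_complex lam)).map_smul
      c (inclusion lam u)
  norm_map' u :=
    (Lp.compMeasurePreservingₗᵢ ℂ s (h.measurePreserving_complex lam)).norm_map (inclusion lam u)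

theorem rep_compIsometry (hlam : 3 < lam) {s : MatSpace ≃ₗ[ℂ] MatSpace}
    (h : IsDomainSymmetry s) (u : BergmanSpace lam) :
    Set.EqOn (rep (compIsometry h lam u)) (rep u ∘ s) domain :=
  eqOn_rep hlam (h.differentiableOn_comp (differentiableOn_rep u)).continuousOn
    ((Lp.coeFn_compMeasurePreserving _ _).trans
      ((h.measurePreserving_complex lam).quasiMeasurePreserving.ae_eq_comp (inclusion_ae_eq u)))

theorem compIsometry_comp_symm (hlam : 3 < lam) {s : MatSpace ≃ₗ[ℂ] MatSpace}
    (h : IsDomainSymmetry s) (u : BergmanSpace lam) :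
    compIsometry h lam (compIsometry h.symm lam u) = u := by
  refine ext_rep fun Z hZ => ?_
  rw [rep_compIsometry hlam h _ hZ, Function.comp_apply,
    rep_compIsometry hlam h.symm _ ((h.mem_iff Z).2 hZ), Function.comp_apply, s.symm_apply_apply]

/-- Composition with a symmetry, as a unitary operator on the Bergman space. -/
noncomputable def compUnitary (hlam : 3 < lam) {s : MatSpace ≃ₗ[ℂ] MatSpace}
    (h : IsDomainSymmetry s) : BergmanSpace lam ≃ₗᵢ[ℂ] BergmanSpace lam :=
  LinearIsometryEquiv.ofSurjective (compIsometry h lam)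
    fun u => ⟨_, compIsometry_comp_symm hlam h u⟩

theorem rep_compUnitary (hlam : 3 < lam) {s : MatSpace ≃ₗ[ℂ] MatSpace}
    (h : IsDomainSymmetry s) (u : BergmanSpace lam) {Z : MatSpace} (hZ : Z ∈ domain) :
    rep (compUnitary hlam h u) Z = rep u (s Z) :=
  rep_compIsometry hlam h u hZ

theorem compUnitary_symm_kernel (hlam : 3 < lam) {s : MatSpace ≃ₗ[ℂ] MatSpace}
    (h : IsDomainSymmetry s) {Z : MatSpace} (hZ : Z ∈ domain) :
    (compUnitary hlam h).symm (kernel lam Z) = kernel lam (s Z) := by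
  refine ext_inner_right ℂ fun u => ?_
  rw [inner_kernel hlam ((h.mem_iff Z).2 hZ), ← LinearIsometryEquiv.inner_map_map (compUnitary hlam h),
    LinearIsometryEquiv.apply_symm_apply, inner_kernel hlam hZ, rep_compUnitary hlam h u hZ]

/-- Conjugation by a composition operator changes the symbol of a Toeplitz operator. -/
theorem inner_toeplitz_compUnitary (hlam : 3 < lam) {s : MatSpace ≃ₗ[ℂ] MatSpace}
    (h : IsDomainSymmetry s) (u w : BergmanSpace lam) {φ ψ : MatSpace → ℂ}
    (hφ : MemLp φ ∞ (volume.restrict domain)) (hψ : MemLp ψ ∞ (volume.restrict domain))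
    (hφψ : ∀ᵐ Z ∂(volume.restrict domain), φ (s Z) = ψ Z) :
    inner ℂ (compUnitary hlam h u) (toeplitz lam ψ hψ (compUnitary hlam h w)) =
      inner ℂ u (toeplitz lam φ hφ w) := by
  rw [inner_toeplitz, inner_toeplitz]
  refine Eq.trans ?_ (IsDomainSymmetry.integral_comp (s := s.restrictScalars ℝ) h lam
    fun Z => star (rep u Z) * (φ Z * rep w Z))
  refine integral_congr_ae ?_
  filter_upwards [(weightedMeasure_absolutelyContinuous lam).ae_le hφψ, ae_mem_domain lam]
    with Z h1 h2
  rw [rep_compUnitary hlam h u h2, rep_compUnitary hlam h w h2, ← h1]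
  rfl

theorem toeplitz_compUnitary (hlam : 3 < lam) {s : MatSpace ≃ₗ[ℂ] MatSpace}
    (h : IsDomainSymmetry s) {φ ψ : MatSpace → ℂ}
    (hφ : MemLp φ ∞ (volume.restrict domain)) (hψ : MemLp ψ ∞ (volume.restrict domain))
    (hφψ : ∀ᵐ Z ∂(volume.restrict domain), φ (s Z) = ψ Z) (w : BergmanSpace lam) :
    toeplitz lam ψ hψ (compUnitary hlam h w) = compUnitary hlam h (toeplitz lam φ hφ w) := by
  refine ext_inner_left ℂ fun u => ?_
  obtain ⟨u, rfl⟩ := (compUnitary hlam h).surjective u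
  rw [inner_toeplitz_compUnitary hlam h u w hφ hψ hφψ, LinearIsometryEquiv.inner_map_map]

end

/-! ### Polarization -/

/-- A locally bounded function that is holomorphic after composition with a norming family of
functionals is holomorphic. -/
theorem differentiableAt_of_norming {E ι : Type*} [NormedAddCommGroup E] [NormedSpace ℂ E]
    [CompleteSpace E] (l : ι → E →L[ℂ] ℂ)
    (hl : ∀ x c, 0 ≤ c → (∀ i, ‖l i x‖ ≤ c) → ‖x‖ ≤ c) (hl1 : ∀ i, ‖l i‖ ≤ 1)
    {f : ℂ → E} {z₀ : ℂ} {r M : ℝ} (hr : 0 < r)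
    (hf : ∀ i, DifferentiableOn ℂ (fun z => l i (f z)) (Metric.ball z₀ r))
    (hM : ∀ z ∈ Metric.ball z₀ r, ‖f z‖ ≤ M) : DifferentiableAt ℂ f z₀ := by
  have hM0 : 0 ≤ M := (norm_nonneg _).trans (hM z₀ (Metric.mem_ball_self hr))
  have hlM : ∀ i, ∀ z ∈ Metric.ball z₀ r, ‖l i (f z)‖ ≤ M := fun i z hz =>
    ((l i).le_of_opNorm_le (hl1 i) _).trans (by simpa using hM z hz)
  have hcont : ContinuousOn f (Metric.ball z₀ (r / 2)) := by
    have hlip : ∀ z ∈ Metric.ball z₀ (r / 2), ∀ w ∈ Metric.ball z (r / 2),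
        ‖f w - f z‖ ≤ (2 * M) / (r / 2) * dist w z := by
      intro z hz w hw
      refine hl _ _ (by positivity) fun i => ?_
      have hsub : Metric.ball z (r / 2) ⊆ Metric.ball z₀ r := by
        intro x hx
        rw [Metric.mem_ball] at hx hz ⊢
        linarith [dist_triangle x z z₀]
      have h := Complex.dist_le_div_mul_dist_of_mapsTo_ball ((hf i).mono hsub)
        (R₂ := 2 * M) (fun x hx => ?_) hw
      · rwa [dist_eq_norm, ← map_sub] at h
      · rw [Metric.mem_closedBall, dist_eq_norm]
        refine (norm_sub_le _ _).trans ?_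
        linarith [hlM i x (hsub hx), hlM i z (hsub (Metric.mem_ball_self (half_pos hr)))]
    intro z hz
    refine ContinuousAt.continuousWithinAt ?_
    rw [ContinuousAt, tendsto_iff_norm_sub_tendsto_zero]
    have h0 : Filter.Tendsto (fun w => (2 * M) / (r / 2) * dist w z) (nhds z) (nhds 0) := by
      have : Continuous fun w : ℂ => (2 * M) / (r / 2) * dist w z := by fun_prop
      simpa using this.tendsto z
    refine squeeze_zero' (Filter.Eventually.of_forall fun w => norm_nonneg _) ?_ h0
    filter_upwards [Metric.ball_mem_nhds z (half_pos hr)] with w hw using hlip z hz w hw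
  set R : NNReal := ⟨r / 4, by positivity⟩ with hR
  have hRr : (R : ℝ) = r / 4 := rfl
  have hR0 : 0 < R := by
    rw [← NNReal.coe_pos, hRr]; positivity
  have hcl : Metric.closedBall z₀ R ⊆ Metric.ball z₀ (r / 2) :=
    Metric.closedBall_subset_ball (by rw [hRr]; linarith)
  have hci : CircleIntegrable f z₀ R :=
    ContinuousOn.circleIntegrable R.2 (hcont.mono (Metric.sphere_subset_closedBall.trans hcl))
  have hps := hasFPowerSeriesOn_cauchy_integral hci hR0
  have heq : ∀ w ∈ Metric.ball z₀ R,
      (2 * ↑Real.pi * Complex.I : ℂ)⁻¹ • ∮ (z : ℂ) in C(z₀, R), (z - w)⁻¹ • f z = f w := by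
    intro w hw
    rw [← sub_eq_zero, ← norm_le_zero_iff]
    refine hl _ _ le_rfl fun i => ?_
    rw [norm_le_zero_iff, map_sub, sub_eq_zero, map_smul]
    have hd : DiffContOnCl ℂ (fun z => l i (f z)) (Metric.ball z₀ R) := by
      refine DifferentiableOn.diffContOnCl ((hf i).mono ?_)
      rw [closure_ball _ (NNReal.coe_pos.2 hR0).ne']
      exact hcl.trans (Metric.ball_subset_ball (by linarith))
    rw [← hd.two_pi_i_inv_smul_circleIntegral_sub_inv_smul hw]
    congr 1
    have hint : CircleIntegrable (fun z => (z - w)⁻¹ • f z) z₀ R := by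
      refine ContinuousOn.circleIntegrable R.2 (ContinuousOn.smul (ContinuousOn.inv₀ (by fun_prop) ?_)
        (hcont.mono (Metric.sphere_subset_closedBall.trans hcl)))
      intro z hz h0
      rw [sub_eq_zero] at h0
      rw [← h0, Metric.mem_ball] at hw
      exact hw.ne hz
    rw [circleIntegral, circleIntegral, ← ContinuousLinearMap.intervalIntegral_comp_comm _ hint.out]
    simp only [map_smul]
  refine (hps.analyticAt.differentiableAt).congr_of_eventuallyEq ?_
  filter_upwards [Metric.ball_mem_nhds z₀ (NNReal.coe_pos.2 hR0)] with w hw using (heq w hw).symm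

/-- A sesqui-holomorphic function on the domain that vanishes on the diagonal vanishes. -/
theorem eq_zero_of_forall_diagonal {K : MatSpace → MatSpace → ℂ}
    (hK : ∀ (P Q : MatSpace) (t : ℂ), P + t • Q ∈ domain → P + star t • Q ∈ domain →
      DifferentiableAt ℂ (fun t => K (P + t • Q) (P + star t • Q)) t)
    (h0 : ∀ Z ∈ domain, K Z Z = 0) {Z W : MatSpace} (hZ : Z ∈ domain) (hW : W ∈ domain) :
    K Z W = 0 := by
  set P : MatSpace := (2⁻¹ : ℂ) • (Z + W) with hP
  set Q : MatSpace := (2 * Complex.I : ℂ)⁻¹ • (Z - W) with hQ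
  have hI : (Complex.I * (2 * Complex.I)⁻¹ : ℂ) = 2⁻¹ := by
    rw [mul_inv, mul_comm (2⁻¹ : ℂ), ← mul_assoc, mul_inv_cancel₀ Complex.I_ne_zero, one_mul]
  have h1 : P + Complex.I • Q = Z := by
    rw [hP, hQ, smul_smul, hI]
    module
  have h2 : P + star Complex.I • Q = W := by
    rw [hP, hQ, smul_smul, Complex.star_def, Complex.conj_I, neg_mul, hI]
    module
  set Ω : Set ℂ := {t | P + t • Q ∈ domain ∧ P + star t • Q ∈ domain} with hΩ
  have hc1 : Continuous fun t : ℂ => P + t • Q := by fun_prop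
  have hc2 : Continuous fun t : ℂ => P + star t • Q :=
    continuous_const.add ((continuous_star (R := ℂ)).smul continuous_const)
  have hΩo : IsOpen Ω := (isOpen_domain.preimage hc1).inter (isOpen_domain.preimage hc2)
  have hΩc : Convex ℝ Ω := by
    have hcomb : ∀ (t u : ℂ) (a b : ℝ), a + b = 1 →
        P + (a • t + b • u) • Q = a • (P + t • Q) + b • (P + u • Q) := by
      intro t u a b hab
      have hb : b = 1 - a := by linarith
      subst hb
      ext i j
      simp
      ring
    intro t ht u hu a b ha hb hab
    refine ⟨?_, ?_⟩
    · rw [hcomb t u a b hab]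
      exact convex_domain ht.1 hu.1 ha hb hab
    · have : star (a • t + b • u) = a • star t + b • star u := by simp
      rw [this, hcomb _ _ a b hab]
      exact convex_domain ht.2 hu.2 ha hb hab
  have hmem : Complex.I ∈ Ω := ⟨by rwa [h1], by rwa [h2]⟩
  have hmem0 : (0 : ℂ) ∈ Ω := by
    have hPD : P ∈ domain := by
      have h3 := convex_domain hZ hW (a := 2⁻¹) (b := 2⁻¹) (by norm_num) (by norm_num) (by norm_num)
      have h4 : P = (2⁻¹ : ℝ) • Z + (2⁻¹ : ℝ) • W := by
        ext i j
        simp [hP]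
      rwa [h4]
    refine ⟨?_, ?_⟩ <;> simpa using hPD
  have han : AnalyticOnNhd ℂ (fun t => K (P + t • Q) (P + star t • Q)) Ω :=
    DifferentiableOn.analyticOnNhd (fun t ht => (hK P Q t ht.1 ht.2).differentiableWithinAt) hΩo
  have hfreq : ∃ᶠ t in nhdsWithin (0 : ℂ) {0}ᶜ, K (P + t • Q) (P + star t • Q) = (0 : ℂ → ℂ) t := by
    have ht : Filter.Tendsto (fun x : ℝ => (x : ℂ)) (nhdsWithin 0 {0}ᶜ)
        (nhdsWithin (0 : ℂ) {0}ᶜ) := by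
      refine tendsto_nhdsWithin_iff.2 ⟨?_, ?_⟩
      · have := Complex.continuous_ofReal.tendsto 0
        exact this.mono_left nhdsWithin_le_nhds
      · filter_upwards [self_mem_nhdsWithin] with x hx
        simpa using hx
    refine ht.frequently (Filter.Eventually.frequently ?_)
    have hev : ∀ᶠ x : ℝ in nhdsWithin 0 {0}ᶜ, (x : ℂ) ∈ Ω := by
      have : ∀ᶠ t in nhdsWithin (0 : ℂ) {0}ᶜ, t ∈ Ω :=
        nhdsWithin_le_nhds (hΩo.mem_nhds hmem0)
      exact ht.eventually this
    filter_upwards [hev] with x hx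
    have hs : star (x : ℂ) = x := Complex.conj_ofReal x
    rw [hs]
    exact h0 _ hx.1
  have := han.eqOn_of_preconnected_of_frequently_eq
    (analyticOnNhd_const (v := (0 : ℂ))) hΩc.isPreconnected hmem0 hfreq hmem
  simp only [h1, h2] at this
  exact this

section
variable {lam : ℝ}

/-- Holomorphy of the sesqui-holomorphic kernel of a bounded operator. -/
theorem differentiableAt_inner_kernel (hlam : 3 < lam)
    (T : BergmanSpace lam →L[ℂ] BergmanSpace lam) {P Q : MatSpace} {t : ℂ}
    (h1 : P + t • Q ∈ domain) (h2 : P + star t • Q ∈ domain) :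
    DifferentiableAt ℂ (fun t => inner ℂ (kernel lam (P + t • Q))
      (T (kernel lam (P + star t • Q)))) t := by
  have hc1 : Continuous fun t : ℂ => P + t • Q := by fun_prop
  have hc2 : Continuous fun t : ℂ => P + star t • Q :=
    continuous_const.add ((continuous_star (R := ℂ)).smul continuous_const)
  have hline : Differentiable ℂ fun t : ℂ => P + t • Q := by fun_prop
  have hloc : ∀ c : ℂ → MatSpace, Continuous c → c t ∈ domain →
      ∃ r : ℝ, 0 < r ∧ ∃ M : ℝ, ∀ s ∈ Metric.ball t r,
        c s ∈ domain ∧ ‖kernel lam (c s)‖ ≤ M := by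
    intro c hc hct
    obtain ⟨r, hr, M, hM⟩ := exists_norm_kernel_le hlam hct
    obtain ⟨ρ, hρ, hρ'⟩ := Metric.continuous_iff.1 hc t r hr
    exact ⟨ρ, hρ, M, fun s hs => hM _ (hρ' s hs)⟩
  have hrep : ∀ u : BergmanSpace lam, ∀ s, P + s • Q ∈ domain →
      DifferentiableAt ℂ (fun s => rep u (P + s • Q)) s := fun u s hs =>
    ((differentiableOn_rep u).differentiableAt (isOpen_domain.mem_nhds hs)).comp s (hline s)
  have d1 : DifferentiableAt ℂ (fun t => innerSL ℂ (kernel lam (P + t • Q))) t := by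
    obtain ⟨r, hr, M, hM⟩ := hloc _ hc1 h1
    refine differentiableAt_of_norming (ι := {u : BergmanSpace lam // ‖u‖ ≤ 1})
      (fun u => ContinuousLinearMap.apply ℂ ℂ (u : BergmanSpace lam)) ?_ ?_ hr (M := M) ?_ ?_
    · intro x c hc hx
      refine ContinuousLinearMap.opNorm_le_of_unit_norm hc fun u hu => ?_
      simpa using hx ⟨u, hu.le⟩
    · intro u
      refine ContinuousLinearMap.opNorm_le_bound _ zero_le_one fun x => ?_
      rw [one_mul]
      exact (x.le_opNorm _).trans (mul_le_of_le_one_right (norm_nonneg _) u.2)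
    · intro u s hs
      refine DifferentiableAt.differentiableWithinAt
        ((hrep u s (hM s hs).1).congr_of_eventuallyEq ?_)
      filter_upwards [Metric.isOpen_ball.mem_nhds hs] with s' hs'
      exact inner_kernel hlam (hM s' hs').1 _
    · intro s hs
      rw [innerSL_apply_norm]
      exact (hM s hs).2
  have d2 : DifferentiableAt ℂ (fun t => kernel lam (P + star t • Q)) t := by
    obtain ⟨r, hr, M, hM⟩ := hloc _ hc2 h2
    refine differentiableAt_of_norming (ι := {u : BergmanSpace lam // ‖u‖ ≤ 1})
      (fun u => innerSL ℂ (u : BergmanSpace lam)) ?_ ?_ hr (M := M) ?_ fun s hs => (hM s hs).2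
    · intro x c hc hx
      have h := ContinuousLinearMap.opNorm_le_of_unit_norm (f := innerSL ℂ x) hc fun u hu => by
        have := hx ⟨u, hu.le⟩
        rw [innerSL_apply_apply] at this ⊢
        rwa [norm_inner_symm]
      rwa [innerSL_apply_norm] at h
    · intro u
      rw [innerSL_apply_norm]
      exact u.2
    · intro u s hs
      have h3 := (hrep u (star s) (hM s hs).1).conj_conj
      rw [Complex.star_def, Complex.conj_conj] at h3
      refine DifferentiableAt.differentiableWithinAt (h3.congr_of_eventuallyEq ?_)
      filter_upwards [Metric.isOpen_ball.mem_nhds hs] with s' hs'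
      simp only [Function.comp_apply, innerSL_apply_apply]
      rw [← inner_conj_symm, inner_kernel hlam (hM s' hs').1, Complex.star_def]
  exact d1.clm_apply (T.differentiableAt.comp t d2)

end

/-! ### Commutativity for `U(2) × 𝕋²` -/

section
variable {lam : ℝ}

theorem toeplitzAlgebra_le {H : Subgroup (U2 × U2)}
    {A : StarSubalgebra ℂ (BergmanSpace lam →L[ℂ] BergmanSpace lam)}
    (hA : IsClosed (A : Set (BergmanSpace lam →L[ℂ] BergmanSpace lam)))
    (h : ∀ φ, ∀ hφ : φ ∈ invariantSymbols H, toeplitz lam φ hφ.1 ∈ A) :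
    toeplitzAlgebra lam H ≤ A := by
  refine StarSubalgebra.topologicalClosure_minimal (StarAlgebra.adjoin_le ?_) hA
  rintro _ ⟨φ, hφ, rfl⟩
  exact h φ hφ

theorem toeplitz_mem {H : Subgroup (U2 × U2)} {φ : MatSpace → ℂ} (hφ : φ ∈ invariantSymbols H) :
    toeplitz lam φ hφ.1 ∈ toeplitzAlgebra lam H :=
  StarSubalgebra.le_topologicalClosure _ (StarAlgebra.subset_adjoin ℂ _ ⟨φ, hφ, rfl⟩)

/-- The action of `U(2) × U(2)` on the Bergman space. -/
noncomputable def actUnitary (hlam : 3 < lam) (h : U2 × U2) :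
    BergmanSpace lam ≃ₗᵢ[ℂ] BergmanSpace lam :=
  compUnitary hlam (isDomainSymmetry_act h)

theorem apply_actUnitary (hlam : 3 < lam) {H : Subgroup (U2 × U2)}
    {T : BergmanSpace lam →L[ℂ] BergmanSpace lam} (hT : T ∈ toeplitzAlgebra lam H)
    {h : U2 × U2} (hh : h ∈ H) (u : BergmanSpace lam) :
    T (actUnitary hlam h u) = actUnitary hlam h (T u) := by
  set U : BergmanSpace lam →L[ℂ] BergmanSpace lam := (actUnitary hlam h : BergmanSpace lam →L[ℂ] BergmanSpace lam) with hU
  have hstar : star U = ((actUnitary hlam h).symm : BergmanSpace lam →L[ℂ] BergmanSpace lam) :=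
    (actUnitary hlam h).adjoint_eq_symm
  have hle : toeplitzAlgebra lam H ≤ StarSubalgebra.centralizer ℂ {U} := by
    refine toeplitzAlgebra_le (Set.isClosed_centralizer _) fun φ hφ => ?_
    have hc : ∀ w, toeplitz lam φ hφ.1 (actUnitary hlam h w) =
        actUnitary hlam h (toeplitz lam φ hφ.1 w) := fun w =>
      toeplitz_compUnitary hlam (isDomainSymmetry_act h) hφ.1 hφ.1 (hφ.2 h hh) w
    rw [StarSubalgebra.mem_centralizer_iff]
    rintro _ rfl
    refine ⟨?_, ?_⟩
    · ext1 w
      exact (hc w).symm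
    · rw [hstar]
      ext1 w
      change (actUnitary hlam h).symm (toeplitz lam φ hφ.1 w) =
        toeplitz lam φ hφ.1 ((actUnitary hlam h).symm w)
      rw [LinearIsometryEquiv.symm_apply_eq, ← hc, LinearIsometryEquiv.apply_symm_apply]
  have := (StarSubalgebra.mem_centralizer_iff ℂ).1 (hle hT) U rfl
  exact (congrArg (fun S => S u) this.1).symm

theorem inner_kernel_act (hlam : 3 < lam) {H : Subgroup (U2 × U2)}
    {T : BergmanSpace lam →L[ℂ] BergmanSpace lam} (hT : T ∈ toeplitzAlgebra lam H)
    {h : U2 × U2} (hh : h ∈ H) {Z W : MatSpace} (hZ : Z ∈ domain) (hW : W ∈ domain) :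
    inner ℂ (kernel lam (act h Z)) (T (kernel lam (act h W))) =
      inner ℂ (kernel lam Z) (T (kernel lam W)) := by
  have h1 : ∀ {Z}, Z ∈ domain → (actUnitary hlam h).symm (kernel lam Z) = kernel lam (act h Z) :=
    fun hZ => compUnitary_symm_kernel hlam (isDomainSymmetry_act h) hZ
  rw [← h1 hZ, ← h1 hW, ← LinearIsometryEquiv.inner_map_map (actUnitary hlam h),
    ← apply_actUnitary hlam hT hh, LinearIsometryEquiv.apply_symm_apply,
    LinearIsometryEquiv.apply_symm_apply]

theorem diagonal_mem_unitaryGroup {a b : ℂ} (ha : a * star a = 1) (hb : b * star b = 1) :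
    Matrix.diagonal ![a, b] ∈ Matrix.unitaryGroup (Fin 2) ℂ := by
  rw [Matrix.mem_unitaryGroup_iff, Matrix.star_eq_conjTranspose, Matrix.diagonal_conjTranspose,
    Matrix.diagonal_mul_diagonal, ← Matrix.diagonal_one]
  congr 1
  ext i
  fin_cases i
  · simpa using ha
  · simpa using hb

/-- The diagonal unitary matrix with given entries. -/
def diagU (a b : ℂ) (ha : a * star a = 1) (hb : b * star b = 1) : U2 :=
  ⟨Matrix.diagonal ![a, b], diagonal_mem_unitaryGroup ha hb⟩

theorem diagU_mem (a b : ℂ) (ha : a * star a = 1) (hb : b * star b = 1) :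
    diagU a b ha hb ∈ diagTorus := Matrix.isDiag_diagonal _

theorem exists_unimodular_mul_eq_star (z : ℂ) : ∃ c : ℂ, c * star c = 1 ∧ c * z = star z := by
  rcases eq_or_ne z 0 with rfl | hz
  · exact ⟨1, by simp, by simp⟩
  · have hz' : star z ≠ 0 := by simpa using hz
    refine ⟨star z / z, ?_, div_mul_cancel₀ _ hz⟩
    rw [star_div₀, star_star]
    field_simp

/-- Every matrix is equivalent to its conjugate under `U(2) × 𝕋²`. -/
theorem exists_act_eq_star (Z : MatSpace) : ∃ h ∈ unitaryTorus, act h Z = star Z := by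
  by_cases hdet : (Matrix.of Z).det = 0
  · obtain ⟨u, w, huw⟩ : ∃ u w : Fin 2 → ℂ, ∀ i j, Z i j = u i * w j := by
      by_cases h0 : Z 0 = 0
      · refine ⟨![0, 1], Z 1, fun i j => ?_⟩
        fin_cases i <;> simp [h0]
      · rw [Matrix.det_fin_two] at hdet
        simp only [Matrix.of_apply] at hdet
        obtain ⟨k, hk⟩ := Function.ne_iff.1 h0
        refine ⟨![1, Z 1 k / Z 0 k], Z 0, fun i j => ?_⟩
        have hk' : Z 0 k ≠ 0 := hk
        fin_cases i
        · simp
        · simp only [Fin.mk_one, Matrix.cons_val_one, Matrix.cons_val_fin_one]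
          field_simp
          fin_cases k <;> fin_cases j <;> simp <;> first | ring1 | linear_combination hdet | linear_combination -hdet
    obtain ⟨a, ha, ha'⟩ := exists_unimodular_mul_eq_star (u 0)
    obtain ⟨b, hb, hb'⟩ := exists_unimodular_mul_eq_star (u 1)
    obtain ⟨c, hc, hc'⟩ := exists_unimodular_mul_eq_star (w 0)
    obtain ⟨d, hd, hd'⟩ := exists_unimodular_mul_eq_star (w 1)
    have hc1 : star c * star (star c) = 1 := by rw [star_star, mul_comm]; exact hc
    have hd1 : star d * star (star d) = 1 := by rw [star_star, mul_comm]; exact hd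
    refine ⟨(diagU a b ha hb, diagU (star c) (star d) hc1 hd1),
      ⟨Subgroup.mem_top _, diagU_mem _ _ hc1 hd1⟩, ?_⟩
    have : Matrix.of (act (diagU a b ha hb, diagU (star c) (star d) hc1 hd1) Z) =
        Matrix.of (star Z) := by
      rw [act_apply]
      ext i j
      simp only [diagU, Matrix.diagonal_conjTranspose, Matrix.mul_diagonal, Matrix.diagonal_mul,
        Matrix.of_apply, Pi.star_apply, huw, star_mul']
      fin_cases i <;> fin_cases j <;> simp only [Fin.zero_eta, Fin.mk_one, Matrix.cons_val_zero,
        Matrix.cons_val_one, Matrix.cons_val_fin_one, star_star, ← ha', ← hb', ← hc',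
        ← hd'] <;> ring
    exact this
  · set X : Matrix (Fin 2) (Fin 2) ℂ := Matrix.of Z with hX
    obtain ⟨b, hb, hb'⟩ := exists_unimodular_mul_eq_star ((Xᴴ * X) 0 1)
    have hb1 : (1 : ℂ) * star 1 = 1 := by simp
    have hb2 : star b * star (star b) = 1 := by rw [star_star, mul_comm]; exact hb
    set B : U2 := diagU 1 (star b) hb1 hb2 with hB
    set Bm : Matrix (Fin 2) (Fin 2) ℂ := (B : Matrix (Fin 2) (Fin 2) ℂ)ᴴ with hBm
    set Y : Matrix (Fin 2) (Fin 2) ℂ := Matrix.of (star Z) with hY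
    set M := X * Bm with hM
    have hBdet : IsUnit Bm.det := by
      have h1 : Bm * (B : Matrix (Fin 2) (Fin 2) ℂ) = 1 := Matrix.mem_unitaryGroup_iff'.1 B.2
      exact (Matrix.isUnit_iff_isUnit_det _).1 (IsUnit.of_mul_eq_one _ h1)
    have hMdet : IsUnit M.det := by
      rw [hM, Matrix.det_mul]
      exact (isUnit_iff_ne_zero.2 hdet).mul hBdet
    have hgram : Mᴴ * M = Yᴴ * Y := by
      have hYX : Yᴴ * Y = (Xᴴ * X)ᵀ := by
        ext i j
        simp [hY, hX, Matrix.mul_apply, Matrix.transpose_apply, mul_comm]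
      have hsymm : (Xᴴ * X) 1 0 = star ((Xᴴ * X) 0 1) := by
        simp [Matrix.mul_apply, mul_comm]
      have hb'' : star b * (Xᴴ * X) 1 0 = (Xᴴ * X) 0 1 := by
        rw [hsymm, ← star_mul', hb', star_star]
      have hMM : Mᴴ * M = (B : Matrix (Fin 2) (Fin 2) ℂ) * (Xᴴ * X) * Bm := by
        rw [hM, Matrix.conjTranspose_mul, hBm, Matrix.conjTranspose_conjTranspose]
        simp only [Matrix.mul_assoc]
      rw [hYX, hMM, hBm, hB]
      ext i j
      simp only [diagU, Matrix.diagonal_conjTranspose, Matrix.mul_diagonal, Matrix.diagonal_mul,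
        Matrix.transpose_apply]
      fin_cases i <;> fin_cases j <;> simp only [Fin.zero_eta, Fin.mk_one, Matrix.cons_val_zero,
        Matrix.cons_val_one, Matrix.cons_val_fin_one, Pi.star_apply, star_star, star_one, one_mul,
        mul_one]
      · rw [mul_comm, hb', hsymm]
      · exact hb''
      · rw [mul_right_comm, mul_comm (star b), hb, one_mul]
    have hA : Y * M⁻¹ ∈ Matrix.unitaryGroup (Fin 2) ℂ := by
      rw [Matrix.mem_unitaryGroup_iff', Matrix.star_eq_conjTranspose, Matrix.conjTranspose_mul,
        Matrix.mul_assoc, ← Matrix.mul_assoc Yᴴ, ← hgram, Matrix.mul_assoc,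
        Matrix.mul_nonsing_inv _ hMdet, Matrix.mul_one, ← Matrix.conjTranspose_mul,
        Matrix.mul_nonsing_inv _ hMdet, Matrix.conjTranspose_one]
    refine ⟨(⟨Y * M⁻¹, hA⟩, B), ⟨Subgroup.mem_top _, diagU_mem _ _ hb1 hb2⟩, ?_⟩
    have : Matrix.of (act (⟨Y * M⁻¹, hA⟩, B) Z) = Matrix.of (star Z) := by
      rw [act_apply, Matrix.mul_assoc]
      change Y * M⁻¹ * M = Y
      rw [Matrix.mul_assoc, Matrix.nonsing_inv_mul _ hMdet, Matrix.mul_one]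
    exact this

theorem star_mem_domain {Z : MatSpace} (hZ : Z ∈ domain) : star Z ∈ domain :=
  (isDomainSymmetry_conj.mem_iff Z).2 hZ

theorem inner_kernel_star (hlam : 3 < lam) {T : BergmanSpace lam →L[ℂ] BergmanSpace lam}
    (hT : T ∈ toeplitzAlgebra lam unitaryTorus) {Z W : MatSpace} (hZ : Z ∈ domain)
    (hW : W ∈ domain) :
    inner ℂ (kernel lam (star W)) (T (kernel lam (star Z))) =
      inner ℂ (kernel lam Z) (T (kernel lam W)) := by
  rw [← sub_eq_zero]
  refine eq_zero_of_forall_diagonal (K := fun Z W => inner ℂ (kernel lam (star W))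
    (T (kernel lam (star Z))) - inner ℂ (kernel lam Z) (T (kernel lam W))) ?_ ?_ hZ hW
  · intro P Q t h1 h2
    refine DifferentiableAt.sub ?_ (differentiableAt_inner_kernel hlam T h1 h2)
    have h3 : ∀ t : ℂ, star (P + star t • Q) = star P + t • star Q := fun t => by
      rw [star_add, star_smul, star_star]
    have h4 : ∀ t : ℂ, star (P + t • Q) = star P + star t • star Q := fun t => by
      rw [star_add, star_smul]
    simp only [h3, h4]
    refine differentiableAt_inner_kernel hlam T ?_ ?_
    · rw [← h3]; exact star_mem_domain h2
    · rw [← h4]; exact star_mem_domain h1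
  · intro Z hZ
    obtain ⟨h, hh, hZh⟩ := exists_act_eq_star Z
    simp only [← hZh, inner_kernel_act hlam hT hh hZ hZ, sub_self]

theorem inner_kernel_mul (hlam : 3 < lam) (S T : BergmanSpace lam →L[ℂ] BergmanSpace lam)
    (Z W : MatSpace) :
    inner ℂ (kernel lam Z) ((S * T) (kernel lam W)) =
      ∫ V, inner ℂ (kernel lam Z) (S (kernel lam V)) * inner ℂ (kernel lam V) (T (kernel lam W))
        ∂(weightedMeasure lam) := by
  rw [mul_apply_eq_comp, ← ContinuousLinearMap.adjoint_inner_left, inner_eq_integral]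
  refine integral_congr_ae ?_
  filter_upwards [ae_mem_domain lam] with V hV
  rw [← inner_kernel hlam hV, ← inner_kernel hlam hV, Complex.star_def, inner_conj_symm,
    ContinuousLinearMap.adjoint_inner_left]

theorem isCommutativeAlgebra_unitaryTorus (hlam : 3 < lam) :
    IsCommutativeAlgebra lam unitaryTorus := by
  intro S hS T hT
  refine eq_of_inner_kernel hlam fun Z hZ W hW => ?_
  rw [← inner_kernel_star hlam (mul_mem hT hS) hZ hW, inner_kernel_mul hlam, inner_kernel_mul hlam,
    ← isDomainSymmetry_conj.integral_comp lam fun V => inner ℂ (kernel lam (star W))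
      (T (kernel lam V)) * inner ℂ (kernel lam V) (S (kernel lam (star Z)))]
  refine integral_congr_ae ?_
  filter_upwards [ae_mem_domain lam] with V hV
  change _ = inner ℂ (kernel lam (star W)) (T (kernel lam (star V))) *
    inner ℂ (kernel lam (star V)) (S (kernel lam (star Z)))
  rw [inner_kernel_star hlam hT hV hW, inner_kernel_star hlam hS hZ hV, mul_comm]

/-! ### The two maximal commutative algebras are unitarily equivalent -/

theorem conjTranspose_transpose_mem {A : Matrix (Fin 2) (Fin 2) ℂ}
    (hA : A ∈ Matrix.unitaryGroup (Fin 2) ℂ) : Aᴴᵀ ∈ Matrix.unitaryGroup (Fin 2) ℂ := by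
  rw [Matrix.mem_unitaryGroup_iff', Matrix.star_eq_conjTranspose] at *
  rw [Matrix.conjTranspose_transpose_eq_transpose_conjTranspose, Matrix.conjTranspose_conjTranspose,
    ← Matrix.transpose_mul, hA, Matrix.transpose_one]

/-- The automorphism of `U(2) × U(2)` that corresponds to the transpose of matrices. -/
def conjSwap (h : U2 × U2) : U2 × U2 :=
  (⟨_, conjTranspose_transpose_mem h.2.2⟩, ⟨_, conjTranspose_transpose_mem h.1.2⟩)

theorem transposeEquiv_act (h : U2 × U2) (Z : MatSpace) :
    transposeEquiv (act h Z) = act (conjSwap h) (transposeEquiv Z) := by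
  have h1 : ∀ W : MatSpace, Matrix.of (transposeEquiv W) = (Matrix.of W)ᵀ := fun _ => rfl
  have : Matrix.of (transposeEquiv (act h Z)) = Matrix.of (act (conjSwap h) (transposeEquiv Z)) := by
    rw [act_apply, h1, act_apply, h1]
    simp only [conjSwap, Matrix.transpose_mul, Matrix.mul_assoc,
      Matrix.conjTranspose_transpose_eq_transpose_conjTranspose, Matrix.conjTranspose_conjTranspose]
  exact this

theorem comp_transpose_mem {H H' : Subgroup (U2 × U2)} (hH : ∀ h ∈ H', conjSwap h ∈ H)
    {φ : MatSpace → ℂ} (hφ : φ ∈ invariantSymbols H) :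
    φ ∘ transposeEquiv ∈ invariantSymbols H' := by
  have hmp : MeasurePreserving transposeEquiv (volume.restrict domain) (volume.restrict domain) :=
    IsDomainSymmetry.measurePreserving_restrict (s := transposeEquiv.restrictScalars ℝ)
      isDomainSymmetry_transpose
  refine ⟨hφ.1.comp_measurePreserving hmp, fun h hh => ?_⟩
  have := hmp.quasiMeasurePreserving.ae (hφ.2 _ (hH h hh))
  filter_upwards [this] with Z hZ
  rw [Function.comp_apply, transposeEquiv_act, hZ, Function.comp_apply]

/-- Composition with the transpose. -/
noncomputable def transposeUnitary (hlam : 3 < lam) : BergmanSpace lam ≃ₗᵢ[ℂ] BergmanSpace lam :=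
  compUnitary hlam isDomainSymmetry_transpose

theorem transposeUnitary_conj_mem (hlam : 3 < lam) {H H' : Subgroup (U2 × U2)}
    (hH : ∀ h ∈ H', conjSwap h ∈ H) {T : BergmanSpace lam →L[ℂ] BergmanSpace lam}
    (hT : T ∈ toeplitzAlgebra lam H) :
    (transposeUnitary hlam).conjStarAlgEquiv T ∈ toeplitzAlgebra lam H' := by
  have hcont : Continuous (transposeUnitary hlam).conjStarAlgEquiv :=
    continuous_const.clm_comp (continuous_id.clm_comp continuous_const)
  have hle : toeplitzAlgebra lam H ≤ (toeplitzAlgebra lam H').comap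
      (transposeUnitary hlam).conjStarAlgEquiv.toStarAlgHom := by
    refine toeplitzAlgebra_le ?_ fun φ hφ => ?_
    · exact (StarSubalgebra.isClosed_topologicalClosure _).preimage hcont
    · have : (transposeUnitary hlam).conjStarAlgEquiv (toeplitz lam φ hφ.1) =
          toeplitz lam _ (comp_transpose_mem hH hφ).1 := by
        ext1 w
        rw [LinearIsometryEquiv.conjStarAlgEquiv_apply_apply]
        have := toeplitz_compUnitary hlam isDomainSymmetry_transpose hφ.1
          (comp_transpose_mem hH hφ).1 (Filter.Eventually.of_forall fun Z => rfl)
          ((transposeUnitary hlam).symm w)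
        refine this.symm.trans (congrArg _ ?_)
        exact (transposeUnitary hlam).apply_symm_apply w
      change (transposeUnitary hlam).conjStarAlgEquiv (toeplitz lam φ hφ.1) ∈ toeplitzAlgebra lam H'
      rw [this]
      exact toeplitz_mem (comp_transpose_mem hH hφ)
  exact hle hT

theorem transposeUnitary_transposeUnitary (hlam : 3 < lam) (u : BergmanSpace lam) :
    transposeUnitary hlam (transposeUnitary hlam u) = u := by
  refine ext_rep fun Z hZ => ?_
  rw [transposeUnitary, rep_compUnitary hlam _ _ hZ,
    rep_compUnitary hlam _ _ ((isDomainSymmetry_transpose.mem_iff Z).2 hZ)]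
  rfl

theorem isDiag_conjTranspose_transpose {A : Matrix (Fin 2) (Fin 2) ℂ} (hA : A.IsDiag) :
    Aᴴᵀ.IsDiag := hA.conjTranspose.transpose

theorem transposeUnitary_image (hlam : 3 < lam) :
    (transposeUnitary hlam).conjStarAlgEquiv '' (toeplitzAlgebra lam unitaryTorus : Set _) =
      toeplitzAlgebra lam torusUnitary := by
  refine Set.Subset.antisymm ?_ fun T hT => ?_
  · rintro _ ⟨T, hT, rfl⟩
    exact transposeUnitary_conj_mem hlam (H := unitaryTorus) (H' := torusUnitary)
      (fun h hh => Subgroup.mem_prod.2 ⟨Subgroup.mem_top _, isDiag_conjTranspose_transpose hh.1⟩) hT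
  · refine ⟨_, transposeUnitary_conj_mem hlam (H := torusUnitary) (H' := unitaryTorus)
      (fun h hh => Subgroup.mem_prod.2 ⟨isDiag_conjTranspose_transpose hh.2, Subgroup.mem_top _⟩) hT, ?_⟩
    have hsymm : ∀ u, (transposeUnitary hlam).symm u = transposeUnitary hlam u := fun u => by
      rw [LinearIsometryEquiv.symm_apply_eq, transposeUnitary_transposeUnitary]
    ext1 w
    rw [LinearIsometryEquiv.conjStarAlgEquiv_apply_apply,
      LinearIsometryEquiv.conjStarAlgEquiv_apply_apply, hsymm, hsymm,
      transposeUnitary_transposeUnitary, transposeUnitary_transposeUnitary]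

end

/-! ### Connected subgroups containing the maximal torus -/

theorem rot_mem (x : ℝ) : (!![(Real.cos x : ℂ), -(Real.sin x : ℂ); (Real.sin x : ℂ),
    (Real.cos x : ℂ)] : Matrix (Fin 2) (Fin 2) ℂ) ∈ Matrix.unitaryGroup (Fin 2) ℂ := by
  have h : (Real.cos x : ℂ) * Real.cos x + Real.sin x * Real.sin x = 1 := by
    exact_mod_cast (by nlinarith [Real.sin_sq_add_cos_sq x] :
      Real.cos x * Real.cos x + Real.sin x * Real.sin x = 1)
  rw [Matrix.mem_unitaryGroup_iff]
  ext i j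
  fin_cases i <;> fin_cases j <;>
    simp [Matrix.mul_apply, Fin.sum_univ_two, Complex.conj_ofReal, -Complex.ofReal_cos,
      -Complex.ofReal_sin] <;> first | ring1 | linear_combination h

/-- The rotation matrices. -/
noncomputable def rot (x : ℝ) : U2 := ⟨_, rot_mem x⟩

theorem rot_add (x y : ℝ) : rot (x + y) = rot x * rot y := by
  refine Subtype.ext ?_
  ext i j
  fin_cases i <;> fin_cases j <;>
    simp [rot, Complex.sin_add, Complex.cos_add] <;> ring

theorem rot_nat_mul (n : ℕ) (x : ℝ) : rot (n * x) = rot x ^ n := by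
  induction n with
  | zero =>
    refine Subtype.ext ?_
    ext i j
    fin_cases i <;> fin_cases j <;> simp [rot]
  | succ n ih => rw [pow_succ, ← ih, ← rot_add]; congr 1; push_cast; ring

theorem exists_unimodular_polar (z : ℂ) : ∃ p : ℂ, p * star p = 1 ∧ z = ‖z‖ * p := by
  rcases eq_or_ne z 0 with rfl | hz
  · exact ⟨1, by simp, by simp⟩
  · have hz' : (‖z‖ : ℂ) ≠ 0 := by simpa using hz
    refine ⟨z / ‖z‖, ?_, by field_simp⟩
    rw [star_div₀, Complex.star_def, Complex.conj_ofReal, div_mul_div_comm, Complex.mul_conj,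
      Complex.normSq_eq_norm_sq]
    push_cast
    field_simp

theorem unitary_row (g : U2) (i : Fin 2) : ‖(g : Matrix (Fin 2) (Fin 2) ℂ) i 0‖ ^ 2 +
    ‖(g : Matrix (Fin 2) (Fin 2) ℂ) i 1‖ ^ 2 = 1 := by
  have h := congrFun (congrFun (Matrix.mem_unitaryGroup_iff.1 g.2) i) i
  simp only [Matrix.mul_apply, Fin.sum_univ_two, Matrix.star_apply, Complex.star_def,
    Complex.mul_conj, Complex.normSq_eq_norm_sq, Matrix.one_apply_eq] at h
  exact_mod_cast h

theorem unitary_second_row (g : U2) : ∃ δ : ℂ, δ * star δ = 1 ∧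
    (g : Matrix (Fin 2) (Fin 2) ℂ) 1 0 = -(δ * star ((g : Matrix (Fin 2) (Fin 2) ℂ) 0 1)) ∧
    (g : Matrix (Fin 2) (Fin 2) ℂ) 1 1 = δ * star ((g : Matrix (Fin 2) (Fin 2) ℂ) 0 0) := by
  have h := Matrix.mem_unitaryGroup_iff.1 g.2
  have h0 := congrFun (congrFun h 0) 0
  have h1 := congrFun (congrFun h 1) 0
  simp only [Matrix.mul_apply, Fin.sum_univ_two, Matrix.star_apply, Matrix.one_apply_eq] at h0
  rw [Matrix.one_apply_ne (by decide)] at h1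
  simp only [Matrix.mul_apply, Fin.sum_univ_two, Matrix.star_apply] at h1
  refine ⟨(g : Matrix (Fin 2) (Fin 2) ℂ).det, ?_, ?_, ?_⟩
  · have := congrArg Matrix.det h
    rwa [Matrix.det_mul, Matrix.star_eq_conjTranspose, Matrix.det_conjTranspose,
      Matrix.det_one] at this
  · rw [Matrix.det_fin_two]
    linear_combination (-(g : Matrix (Fin 2) (Fin 2) ℂ) 1 0) * h0 +
      (g : Matrix (Fin 2) (Fin 2) ℂ) 0 0 * h1
  · rw [Matrix.det_fin_two]
    linear_combination (-(g : Matrix (Fin 2) (Fin 2) ℂ) 1 1) * h0 +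
      (g : Matrix (Fin 2) (Fin 2) ℂ) 0 1 * h1

theorem mem_diagTorus_of_norm_eq_one {g : U2} (h : ‖(g : Matrix (Fin 2) (Fin 2) ℂ) 0 0‖ = 1) :
    g ∈ diagTorus := by
  have h1 := unitary_row g 0
  have h2 : (g : Matrix (Fin 2) (Fin 2) ℂ) 0 1 = 0 := by
    rw [h] at h1
    simpa using h1
  obtain ⟨δ, -, h3, -⟩ := unitary_second_row g
  rw [h2, star_zero, mul_zero, neg_zero] at h3
  intro i j hij
  fin_cases i <;> fin_cases j
  · exact absurd rfl hij
  · exact h2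
  · exact h3
  · exact absurd rfl hij

theorem norm_apply_le_one (g : U2) : ‖(g : Matrix (Fin 2) (Fin 2) ℂ) 0 0‖ ≤ 1 := by
  nlinarith [unitary_row g 0, norm_nonneg ((g : Matrix (Fin 2) (Fin 2) ℂ) 0 0),
    sq_nonneg ‖(g : Matrix (Fin 2) (Fin 2) ℂ) 0 1‖]

/-- The Cartan decomposition of `U(2)` with respect to the diagonal torus. -/
theorem exists_eq_mul_rot_mul (g : U2) : ∃ t ∈ diagTorus, ∃ s ∈ diagTorus,
    g = t * rot (Real.arccos ‖(g : Matrix (Fin 2) (Fin 2) ℂ) 0 0‖) * s := by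
  obtain ⟨δ, hδ, h10, h11⟩ := unitary_second_row g
  obtain ⟨p, hp, h00⟩ := exists_unimodular_polar ((g : Matrix (Fin 2) (Fin 2) ℂ) 0 0)
  obtain ⟨q, hq, h01⟩ := exists_unimodular_polar (-(g : Matrix (Fin 2) (Fin 2) ℂ) 0 1)
  have hcos : Real.cos (Real.arccos ‖(g : Matrix (Fin 2) (Fin 2) ℂ) 0 0‖) =
      ‖(g : Matrix (Fin 2) (Fin 2) ℂ) 0 0‖ :=
    Real.cos_arccos (by linarith [norm_nonneg ((g : Matrix (Fin 2) (Fin 2) ℂ) 0 0)])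
      (norm_apply_le_one g)
  have hsin : Real.sin (Real.arccos ‖(g : Matrix (Fin 2) (Fin 2) ℂ) 0 0‖) =
      ‖-(g : Matrix (Fin 2) (Fin 2) ℂ) 0 1‖ := by
    rw [Real.sin_arccos, norm_neg, Real.sqrt_eq_iff_mul_self_eq
      (by linarith [unitary_row g 0, sq_nonneg ‖(g : Matrix (Fin 2) (Fin 2) ℂ) 0 1‖])
      (norm_nonneg _)]
    linarith [unitary_row g 0]
  have hone : (1 : ℂ) * star 1 = 1 := by simp
  have hr : (δ * star p * star q) * star (δ * star p * star q) = 1 := by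
    simp only [star_mul', star_star]
    linear_combination (p * star p * q * star q) * hδ + (q * star q) * hp + hq
  refine ⟨diagU 1 _ hone hr, diagU_mem _ _ _ _, diagU p q hp hq, diagU_mem _ _ _ _,
    Subtype.ext ?_⟩
  have hs0 := congrArg star h00
  have hs1 := congrArg star h01
  have hreal : ∀ r : ℝ, star (r : ℂ) = r := Complex.conj_ofReal
  rw [star_mul', hreal] at hs0 hs1
  rw [star_neg] at hs1
  ext i j
  simp only [diagU, Submonoid.coe_mul, rot, hcos, hsin, Matrix.mul_diagonal,
    Matrix.diagonal_mul]
  fin_cases i <;> fin_cases j <;> simp only [Fin.zero_eta, Fin.mk_one, Matrix.cons_val_zero,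
    Matrix.cons_val_one, Matrix.cons_val_fin_one, Matrix.of_apply, Matrix.cons_val',
    one_mul]
  · exact h00
  · linear_combination -h01
  · rw [h10]
    linear_combination δ * hs1 - (δ * star q * ‖-(g : Matrix (Fin 2) (Fin 2) ℂ) 0 1‖) * hp
  · rw [h11]
    linear_combination δ * hs0 - (δ * star p * ‖(g : Matrix (Fin 2) (Fin 2) ℂ) 0 0‖) * hq

theorem rot_arccos_mem {K : Subgroup U2} (hK : diagTorus ≤ K) {g : U2} (hg : g ∈ K) :
    rot (Real.arccos ‖(g : Matrix (Fin 2) (Fin 2) ℂ) 0 0‖) ∈ K := by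
  obtain ⟨t, ht, s, hs, h⟩ := exists_eq_mul_rot_mul g
  have h1 : t * rot (Real.arccos ‖(g : Matrix (Fin 2) (Fin 2) ℂ) 0 0‖) * s ∈ K := h ▸ hg
  rwa [Subgroup.mul_mem_cancel_right _ (hK hs), Subgroup.mul_mem_cancel_left _ (hK ht)] at h1

/-- The diagonal torus and a non-monomial conjugate of it generate `U(2)`. -/
theorem eq_top_of_conj_torus {K : Subgroup U2} (hK : diagTorus ≤ K) {A : U2}
    (h0 : 0 < ‖(A : Matrix (Fin 2) (Fin 2) ℂ) 0 0‖)
    (h1 : ‖(A : Matrix (Fin 2) (Fin 2) ℂ) 0 0‖ < 1)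
    (hA : ∀ t ∈ diagTorus, A * t * A⁻¹ ∈ K) : K = ⊤ := by
  set c : ℝ := ‖(A : Matrix (Fin 2) (Fin 2) ℂ) 0 0‖ ^ 2 with hc
  have hc0 : 0 < c := by positivity
  have hc1 : c < 1 := by
    rw [hc]; nlinarith
  have hone : (1 : ℂ) * star 1 = 1 := by simp
  have hunit : ∀ x : ℝ, Complex.exp (x * Complex.I) * star (Complex.exp (x * Complex.I)) = 1 := by
    intro x
    rw [Complex.star_def, Complex.mul_conj, Complex.normSq_eq_norm_sq,
      Complex.norm_exp_ofReal_mul_I]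
    simp
  have hent : ∀ x : ℝ, ((A * diagU _ 1 (hunit x) hone * A⁻¹ : U2) :
      Matrix (Fin 2) (Fin 2) ℂ) 0 0 = c * Complex.exp (x * Complex.I) + (1 - c) := by
    intro x
    have hrow : (c : ℂ) + (A : Matrix (Fin 2) (Fin 2) ℂ) 0 1 *
        star ((A : Matrix (Fin 2) (Fin 2) ℂ) 0 1) = 1 := by
      rw [Complex.star_def, Complex.mul_conj, Complex.normSq_eq_norm_sq, hc]
      exact_mod_cast unitary_row A 0
    have hcc : (A : Matrix (Fin 2) (Fin 2) ℂ) 0 0 *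
        star ((A : Matrix (Fin 2) (Fin 2) ℂ) 0 0) = c := by
      rw [Complex.star_def, Complex.mul_conj, Complex.normSq_eq_norm_sq, hc]
    have : ((A * diagU _ 1 (hunit x) hone * A⁻¹ : U2) : Matrix (Fin 2) (Fin 2) ℂ) 0 0 =
        (A : Matrix (Fin 2) (Fin 2) ℂ) 0 0 * Complex.exp (x * Complex.I) *
          star ((A : Matrix (Fin 2) (Fin 2) ℂ) 0 0) +
        (A : Matrix (Fin 2) (Fin 2) ℂ) 0 1 * star ((A : Matrix (Fin 2) (Fin 2) ℂ) 0 1) := by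
      change ((A : Matrix (Fin 2) (Fin 2) ℂ) *
        Matrix.diagonal ![Complex.exp (x * Complex.I), 1] *
        star (A : Matrix (Fin 2) (Fin 2) ℂ) : Matrix (Fin 2) (Fin 2) ℂ) 0 0 = _
      rw [Matrix.mul_apply, Fin.sum_univ_two, Matrix.mul_diagonal, Matrix.mul_diagonal]
      simp [Matrix.star_apply]
    rw [this]
    linear_combination Complex.exp (x * Complex.I) * hcc + hrow
  have hsmall : ∀ y : ℝ, |1 - 2 * c| ≤ y → y ≤ 1 → rot (Real.arccos y) ∈ K := by
    intro y hy hy1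
    have hcont : Continuous fun x : ℝ => ‖(c : ℂ) * Complex.exp (x * Complex.I) + (1 - c)‖ := by
      fun_prop
    have hv0 : ‖(c : ℂ) * Complex.exp ((0 : ℝ) * Complex.I) + (1 - c)‖ = 1 := by
      simp
    have hvpi : ‖(c : ℂ) * Complex.exp ((Real.pi : ℝ) * Complex.I) + (1 - c)‖ = |1 - 2 * c| := by
      rw [Complex.exp_pi_mul_I, ← Real.norm_eq_abs, ← Complex.norm_real]
      congr 1
      push_cast
      ring
    obtain ⟨x, -, hx⟩ := intermediate_value_Icc' Real.pi_pos.le hcont.continuousOn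
      (show y ∈ Set.Icc _ _ from ⟨hvpi.le.trans hy, hy1.trans hv0.ge⟩)
    have := rot_arccos_mem hK (hA _ (diagU_mem _ 1 (hunit x) hone))
    rw [hent] at this
    simpa only [hx] using this
  have hm1 : |1 - 2 * c| < 1 := by
    rw [abs_lt]; constructor <;> linarith
  set a : ℝ := Real.arccos |1 - 2 * c| with ha
  have ha0 : 0 < a := Real.arccos_pos.2 hm1
  have hrot : ∀ x : ℝ, 0 ≤ x → rot x ∈ K := by
    intro x hx
    obtain ⟨n, hn⟩ := exists_nat_gt (x / a)
    have hn0 : (0 : ℝ) < n := (div_nonneg hx ha0.le).trans_lt hn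
    have hxn : x / n ≤ a := by
      rw [div_lt_iff₀ ha0] at hn
      rw [div_le_iff₀ hn0]
      linarith
    have h2 : x = n * (x / n) := by field_simp
    rw [h2, rot_nat_mul]
    refine Subgroup.pow_mem _ ?_ n
    have hxn0 : 0 ≤ x / n := by positivity
    have hpi : a ≤ Real.pi := Real.arccos_le_pi _
    rw [← Real.arccos_cos hxn0 (hxn.trans hpi)]
    refine hsmall _ ?_ (Real.cos_le_one _)
    have h3 := Real.cos_le_cos_of_nonneg_of_le_pi hxn0 hpi hxn
    rwa [ha, Real.cos_arccos (by linarith [abs_nonneg (1 - 2 * c)]) hm1.le] at h3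
  refine (Subgroup.eq_top_iff' K).2 fun g => ?_
  obtain ⟨t, ht, s, hs, h⟩ := exists_eq_mul_rot_mul g
  rw [h]
  exact mul_mem (mul_mem (hK ht) (hrot _ (Real.arccos_nonneg _))) (hK hs)

theorem diag_or_forall_mem {H : Subgroup (U2 × U2)}
    (hconn : IsConnected (H : Set (U2 × U2))) (π : U2 × U2 →* U2) (hπ : Continuous π)
    (ι : U2 →* U2 × U2) (hι : ∀ h t, h * ι t * h⁻¹ = ι (π h * t * (π h)⁻¹))
    (hT : ∀ t ∈ diagTorus, ι t ∈ H) :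
    (∀ h ∈ H, π h ∈ diagTorus) ∨ ∀ A, ι A ∈ H := by
  by_cases hall : ∀ h ∈ H, ‖(π h : Matrix (Fin 2) (Fin 2) ℂ) 0 0‖ = 1
  · exact Or.inl fun h hh => mem_diagTorus_of_norm_eq_one (hall h hh)
  · right
    push Not at hall
    obtain ⟨h, hh, hne⟩ := hall
    have hlt := lt_of_le_of_ne (norm_apply_le_one (π h)) hne
    obtain ⟨g, hg, hg0, hg1⟩ : ∃ g ∈ H, 0 < ‖(π g : Matrix (Fin 2) (Fin 2) ℂ) 0 0‖ ∧
        ‖(π g : Matrix (Fin 2) (Fin 2) ℂ) 0 0‖ < 1 := by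
      rcases (norm_nonneg ((π h : Matrix (Fin 2) (Fin 2) ℂ) 0 0)).eq_or_lt with h0 | h0
      · have hc : Continuous fun g => ‖(π g : Matrix (Fin 2) (Fin 2) ℂ) 0 0‖ :=
          ((continuous_subtype_val.comp hπ).matrix_elem 0 0).norm
        obtain ⟨g, hg, hg'⟩ := hconn.isPreconnected.intermediate_value hh H.one_mem hc.continuousOn
          (show (1 / 2 : ℝ) ∈ Set.Icc _ _ by
            rw [← h0]
            norm_num [map_one])
        exact ⟨g, hg, by simp only [hg']; norm_num, by simp only [hg']; norm_num⟩
      · exact ⟨h, hh, h0, hlt⟩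
    have := eq_top_of_conj_torus (K := H.comap ι) hT hg0 hg1 fun t ht => by
      rw [Subgroup.mem_comap, ← hι]
      exact mul_mem (mul_mem hg (hT t ht)) (inv_mem hg)
    intro A
    have hA : A ∈ H.comap ι := this ▸ Subgroup.mem_top A
    exact hA

theorem connected_subgroup_cases {H : Subgroup (U2 × U2)} (hT : torus4 ≤ H)
    (hconn : IsConnected (H : Set (U2 × U2))) :
    H = torus4 ∨ H = ⊤ ∨ H = unitaryTorus ∨ H = torusUnitary := by
  have h1 := diag_or_forall_mem hconn (MonoidHom.fst U2 U2) continuous_fst (MonoidHom.inl U2 U2)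
    (fun h t => by ext1 <;> simp) fun t ht => hT ⟨ht, one_mem diagTorus⟩
  have h2 := diag_or_forall_mem hconn (MonoidHom.snd U2 U2) continuous_snd (MonoidHom.inr U2 U2)
    (fun h t => by ext1 <;> simp) fun t ht => hT ⟨one_mem diagTorus, ht⟩
  have hmul : ∀ A B : U2, ((A, B) : U2 × U2) = (A, 1) * (1, B) := fun A B => by simp
  rcases h1 with h1 | h1 <;> rcases h2 with h2 | h2
  · exact Or.inl (le_antisymm (fun h hh => ⟨h1 h hh, h2 h hh⟩) hT)
  · refine Or.inr (Or.inr (Or.inr (le_antisymm (fun h hh => ⟨h1 h hh, Subgroup.mem_top _⟩) ?_)))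
    rintro ⟨A, B⟩ ⟨hA, -⟩
    rw [hmul]
    exact mul_mem (hT ⟨hA, one_mem diagTorus⟩) (h2 B)
  · refine Or.inr (Or.inr (Or.inl (le_antisymm (fun h hh => ⟨Subgroup.mem_top _, h2 h hh⟩) ?_)))
    rintro ⟨A, B⟩ ⟨-, hB⟩
    rw [hmul]
    exact mul_mem (h1 A) (hT ⟨one_mem diagTorus, hB⟩)
  · refine Or.inr (Or.inl ((Subgroup.eq_top_iff' H).2 ?_))
    rintro ⟨A, B⟩
    rw [hmul]
    exact mul_mem (h1 A) (h2 B)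

/-! ### Finiteness of the weighted measures -/

theorem lintegral_Ioo_mul_rpow_le {A C p : ℝ} (hA : 0 < A) (hC0 : 0 < C) (hC : C ≤ 1)
    (hp : -1 < p) :
    ∫⁻ r in Set.Ioo 0 (Real.sqrt (C / A)), ENNReal.ofReal (r * (C - A * r ^ 2) ^ p) ≤
      ENNReal.ofReal (1 / (2 * A * (p + 1))) := by
  set R := Real.sqrt (C / A) with hR
  have hR2 : A * R ^ 2 = C := by
    rw [hR, Real.sq_sqrt (by positivity)]; field_simp
  have hR0 : 0 ≤ R := Real.sqrt_nonneg _
  have hp1 : 0 < p + 1 := by linarith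
  have hpos : ∀ r ∈ Set.Ioo 0 R, 0 < C - A * r ^ 2 := by
    intro r hr
    have : r ^ 2 < R ^ 2 := by nlinarith [hr.1, hr.2]
    nlinarith
  set F : ℝ → ℝ := fun r => -((C - A * r ^ 2) ^ (p + 1)) / (2 * A * (p + 1)) with hF
  have hcont : ContinuousOn F (Set.Icc 0 R) := by
    refine ContinuousOn.div_const (ContinuousOn.neg ?_) _
    exact ContinuousOn.rpow_const (by fun_prop) fun r _ => Or.inr hp1.le
  have hder : ∀ r ∈ Set.Ioo 0 R, HasDerivAt F (r * (C - A * r ^ 2) ^ p) r := by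
    intro r hr
    have h1 : HasDerivAt (fun r : ℝ => C - A * r ^ 2) (-(A * (2 * r))) r := by
      simpa using ((hasDerivAt_pow 2 r).const_mul A).const_sub C
    have h2 := (h1.rpow_const (p := p + 1) (Or.inl (hpos r hr).ne')).neg.div_const
      (2 * A * (p + 1))
    refine h2.congr_deriv ?_
    rw [add_sub_cancel_right]
    field_simp
  have hnn : ∀ r ∈ Set.Ioo 0 R, 0 ≤ r * (C - A * r ^ 2) ^ p := fun r hr =>
    mul_nonneg hr.1.le (Real.rpow_nonneg (hpos r hr).le _)
  have hint := intervalIntegral.integrableOn_deriv_of_nonneg hcont hder hnn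
  have hval := intervalIntegral.integral_eq_sub_of_hasDerivAt_of_le hR0 hcont hder
    ((intervalIntegrable_iff_integrableOn_Ioc_of_le hR0).2 hint)
  rw [intervalIntegral.integral_of_le hR0, integral_Ioc_eq_integral_Ioo] at hval
  rw [← ofReal_integral_eq_lintegral_ofReal (hint.mono_set Set.Ioo_subset_Ioc_self)
    ((ae_restrict_iff' measurableSet_Ioo).2 (Filter.Eventually.of_forall hnn)), hval]
  refine ENNReal.ofReal_le_ofReal ?_
  simp only [hF, hR2, sub_self, Real.zero_rpow hp1.ne']
  have h3 : C ^ (p + 1) ≤ 1 := Real.rpow_le_one hC0.le hC hp1.le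
  rw [show (-0 / (2 * A * (p + 1)) - -(C - A * 0 ^ 2) ^ (p + 1) / (2 * A * (p + 1))) =
    C ^ (p + 1) / (2 * A * (p + 1)) by simp; ring]
  gcongr

/-- The density in one variable, integrated. -/
theorem lintegral_indicator_rpow_le {A C p : ℝ} (hA : 0 < A) (hC : C ≤ 1) (hp : -1 < p) (x₀ : ℂ) :
    ∫⁻ x : ℂ, {x : ℂ | 0 < C - A * ‖x - x₀‖ ^ 2}.indicator
      (fun x => ENNReal.ofReal ((C - A * ‖x - x₀‖ ^ 2) ^ p)) x ≤
      ENNReal.ofReal (Real.pi / (A * (p + 1))) := by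
  have hp1 : 0 < p + 1 := by linarith
  set g : ℂ → ℝ≥0∞ := {x : ℂ | 0 < C - A * ‖x‖ ^ 2}.indicator
      (fun x => ENNReal.ofReal ((C - A * ‖x‖ ^ 2) ^ p)) with hg
  have h1 : ∫⁻ x : ℂ, {x : ℂ | 0 < C - A * ‖x - x₀‖ ^ 2}.indicator
      (fun x => ENNReal.ofReal ((C - A * ‖x - x₀‖ ^ 2) ^ p)) x = ∫⁻ x, g x :=
    lintegral_sub_right_eq_self g x₀
  rw [h1]
  rcases le_or_gt C 0 with hC0 | hC0
  · have : g = 0 := by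
      refine funext fun x => Set.indicator_of_notMem (fun hx => ?_) _
      have hx' : 0 < C - A * ‖x‖ ^ 2 := hx
      nlinarith [mul_nonneg hA.le (sq_nonneg ‖x‖)]
    rw [this]
    simp
  set R := Real.sqrt (C / A) with hR
  set G : ℝ → ℝ≥0∞ := (Set.Ioo 0 R).indicator
    (fun r => ENNReal.ofReal (r * (C - A * r ^ 2) ^ p)) with hG
  have hgG : ∀ q ∈ Complex.polarCoord.target,
      ENNReal.ofReal q.1 • g (Complex.polarCoord.symm q) ≤ G q.1 := by
    intro q hq
    rw [Complex.polarCoord_target] at hq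
    have hq0 : 0 < q.1 := hq.1
    have hn : ‖Complex.polarCoord.symm q‖ = q.1 := by
      rw [Complex.norm_polarCoord_symm, abs_of_pos hq0]
    by_cases hm : 0 < C - A * q.1 ^ 2
    · have hmem : q.1 ∈ Set.Ioo 0 R := by
        refine ⟨hq0, ?_⟩
        rw [hR, Real.lt_sqrt hq0.le, lt_div_iff₀ hA]
        linarith
      rw [hG, Set.indicator_of_mem hmem, hg, Set.indicator_of_mem (by
        rw [Set.mem_ofPred_eq, hn]; exact hm), hn, smul_eq_mul, ENNReal.ofReal_mul hq0.le]
    · rw [hg, Set.indicator_of_notMem (by rw [Set.mem_ofPred_eq, hn]; exact hm), smul_zero]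
      exact zero_le
  have hGm : Measurable G := by
    refine Measurable.indicator ?_ measurableSet_Ioo
    exact (measurable_id.mul ((measurable_const.sub
      ((measurable_id.pow_const 2).const_mul A)).pow_const p)).ennreal_ofReal
  rw [← Complex.lintegral_comp_polarCoord_symm]
  calc ∫⁻ q in polarCoord.target, ENNReal.ofReal q.1 • g (Complex.polarCoord.symm q)
      ≤ ∫⁻ q in polarCoord.target, G q.1 := setLIntegral_mono' (by measurability) hgG
    _ = ∫⁻ r in Set.Ioi 0, ∫⁻ _ in Set.Ioo (-Real.pi) Real.pi, G r := by
        rw [polarCoord_target, Measure.volume_eq_prod,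
          setLIntegral_prod (fun q : ℝ × ℝ => G q.1) (hGm.comp measurable_fst).aemeasurable]
    _ = ENNReal.ofReal (2 * Real.pi) * ∫⁻ r in Set.Ioi 0, G r := by
        simp_rw [setLIntegral_const, Real.volume_Ioo]
        rw [lintegral_mul_const _ hGm, mul_comm]
        congr 2
        ring
    _ ≤ ENNReal.ofReal (2 * Real.pi) * ENNReal.ofReal (1 / (2 * A * (p + 1))) := by
        refine mul_le_mul_right ?_ _
        refine (setLIntegral_le_lintegral _ _).trans ?_
        rw [hG, lintegral_indicator measurableSet_Ioo]
        exact lintegral_Ioo_mul_rpow_le hA hC0 hC hp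
    _ = _ := by
        rw [← ENNReal.ofReal_mul (by positivity)]
        congr 1
        field_simp

/-- The matrix with given entries. -/
def mk (q : (ℂ × ℂ) × (ℂ × ℂ)) : MatSpace := ![![q.1.1, q.1.2], ![q.2.1, q.2.2]]

theorem measurePreserving_mk : MeasurePreserving mk volume volume := by
  have h1 := (volume_preserving_piFinTwo fun _ => ℂ).symm
  have h2 := (volume_preserving_piFinTwo fun _ => Fin 2 → ℂ).symm
  exact h2.comp (h1.prod h1)

theorem gapDet_mk (a b c x : ℂ) (ha : ‖a‖ < 1) :
    gapDet (mk ((a, b), (c, x))) =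
      (1 - ‖a‖ ^ 2 - ‖b‖ ^ 2) * (1 - ‖a‖ ^ 2 - ‖c‖ ^ 2) / (1 - ‖a‖ ^ 2) -
      (1 - ‖a‖ ^ 2) * ‖x - (-(star a * b * c) / (1 - ‖a‖ ^ 2 : ℝ))‖ ^ 2 := by
  have hA : 1 - Complex.normSq a ≠ 0 := by
    rw [Complex.normSq_eq_norm_sq]
    nlinarith [norm_nonneg a]
  rw [gapDet_eq]
  simp only [← Complex.normSq_eq_norm_sq, mk, Matrix.cons_val_zero, Matrix.cons_val_one,
    Matrix.cons_val_fin_one]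
  have h1 : Complex.normSq (x - (-(star a * b * c) / (1 - Complex.normSq a : ℝ))) =
      Complex.normSq (x * (1 - Complex.normSq a : ℝ) + star a * b * c) /
        (1 - Complex.normSq a) ^ 2 := by
    have hA' : ((1 - Complex.normSq a : ℝ) : ℂ) ≠ 0 := by exact_mod_cast hA
    rw [eq_div_iff (pow_ne_zero 2 hA), sq, ← Complex.normSq_ofReal, ← Complex.normSq_mul]
    congr 1
    field_simp
    ring
  rw [h1]
  field_simp
  simp only [Complex.normSq_apply, Complex.add_re, Complex.add_im, Complex.mul_re, Complex.mul_im,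
    Complex.sub_re, Complex.sub_im, Complex.ofReal_re, Complex.ofReal_im, Complex.star_def,
    Complex.conj_re, Complex.conj_im]
  ring

/-- The density `c_λ det (I₂ - Z Z*) ^ (λ - 4)`, extended by zero outside the domain. -/
noncomputable def density (lam : ℝ) : MatSpace → ℝ≥0∞ :=
  domain.indicator fun Z => ENNReal.ofReal (weight lam Z)

theorem measurable_density (lam : ℝ) : Measurable (density lam) :=
  (measurable_weight lam).ennreal_ofReal.indicator isOpen_domain.measurableSet

theorem of_density_mk_ne_zero {lam : ℝ} {a b c x : ℂ} (h : density lam (mk ((a, b), (c, x))) ≠ 0) :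
    ‖a‖ ^ 2 + ‖b‖ ^ 2 < 1 ∧ ‖c‖ < 1 ∧ 0 < gapDet (mk ((a, b), (c, x))) := by
  have hZ := Set.mem_of_indicator_ne_zero h
  refine ⟨?_, norm_apply_lt_one hZ 1 0, gapDet_pos hZ⟩
  have := normSq_add_normSq_lt_one hZ 0
  rwa [Complex.normSq_eq_norm_sq, Complex.normSq_eq_norm_sq] at this

theorem lintegral_density_fst_le {lam : ℝ} (hlam : 3 < lam) (a b c : ℂ) :
    ∫⁻ x, density lam (mk ((a, b), (c, x))) ≤
      (Metric.ball (0 : ℂ) 1).indicator (fun a =>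
        (Metric.ball (0 : ℂ) (Real.sqrt (1 - ‖a‖ ^ 2))).indicator (fun _ =>
          (Metric.ball (0 : ℂ) 1).indicator (fun _ => ENNReal.ofReal (weightConst lam *
            (Real.pi / ((1 - ‖a‖ ^ 2) * (lam - 3))))) c) b) a := by
  by_cases h : ∀ x, density lam (mk ((a, b), (c, x))) = 0
  · simp [h]
  push Not at h
  obtain ⟨x₁, hx₁⟩ := h
  obtain ⟨hab, hc, hgap⟩ := of_density_mk_ne_zero hx₁
  have ha : ‖a‖ < 1 := by nlinarith [sq_nonneg ‖b‖, norm_nonneg a]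
  have hA : 0 < 1 - ‖a‖ ^ 2 := by nlinarith [norm_nonneg a]
  rw [Set.indicator_of_mem (by simpa using ha), Set.indicator_of_mem (by
    rw [mem_ball_zero_iff, Real.lt_sqrt (norm_nonneg _)]; linarith),
    Set.indicator_of_mem (by simpa using hc)]
  have hw0 : 0 ≤ weightConst lam := by
    have h1 : 0 < lam - 3 := by linarith
    have h3 : 0 < lam - 1 := by linarith
    unfold weightConst
    positivity
  set A := 1 - ‖a‖ ^ 2 with hAdef
  set C := (A - ‖b‖ ^ 2) * (A - ‖c‖ ^ 2) / A with hC
  set x₀ : ℂ := -(star a * b * c) / (A : ℝ) with hx₀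
  have hg : ∀ x, gapDet (mk ((a, b), (c, x))) = C - A * ‖x - x₀‖ ^ 2 := fun x =>
    gapDet_mk a b c x ha
  have hC1 : C ≤ 1 := by
    have hb : 0 < A - ‖b‖ ^ 2 := by linarith
    rw [hC, div_le_iff₀ hA]
    have h1 : A - ‖b‖ ^ 2 ≤ A := by linarith [sq_nonneg ‖b‖]
    have h2 : A - ‖c‖ ^ 2 ≤ 1 := by nlinarith [sq_nonneg ‖c‖, sq_nonneg ‖a‖]
    nlinarith
  calc ∫⁻ x, density lam (mk ((a, b), (c, x)))
      ≤ ∫⁻ x, ENNReal.ofReal (weightConst lam) * {x : ℂ | 0 < C - A * ‖x - x₀‖ ^ 2}.indicator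
        (fun x => ENNReal.ofReal ((C - A * ‖x - x₀‖ ^ 2) ^ (lam - 4))) x := by
        refine lintegral_mono fun x => ?_
        by_cases hx : density lam (mk ((a, b), (c, x))) = 0
        · simp [hx]
        · have hpos := (of_density_mk_ne_zero hx).2.2
          rw [hg] at hpos
          rw [Set.indicator_of_mem (show x ∈ {x : ℂ | 0 < C - A * ‖x - x₀‖ ^ 2} from hpos),
            density, Set.indicator_of_mem (Set.mem_of_indicator_ne_zero hx), weight, hg,
            ENNReal.ofReal_mul hw0]
    _ = ENNReal.ofReal (weightConst lam) * ∫⁻ x, {x : ℂ | 0 < C - A * ‖x - x₀‖ ^ 2}.indicator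
        (fun x => ENNReal.ofReal ((C - A * ‖x - x₀‖ ^ 2) ^ (lam - 4))) x :=
        lintegral_const_mul' _ _ ENNReal.ofReal_ne_top
    _ ≤ ENNReal.ofReal (weightConst lam) *
        ENNReal.ofReal (Real.pi / (A * (lam - 4 + 1))) :=
        mul_le_mul_right (lintegral_indicator_rpow_le hA hC1 (by linarith) x₀) _
    _ = _ := by
        rw [← ENNReal.ofReal_mul hw0, show lam - 4 + 1 = lam - 3 by ring]

theorem lintegral_density_ne_top {lam : ℝ} (hlam : 3 < lam) : ∫⁻ Z, density lam Z ≠ ∞ := by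
  have hm : Measurable fun q => density lam (mk q) :=
    (measurable_density lam).comp measurePreserving_mk.measurable
  rw [← measurePreserving_mk.lintegral_comp (measurable_density lam), Measure.volume_eq_prod,
    lintegral_prod _ hm.aemeasurable, Measure.volume_eq_prod,
    lintegral_prod _ hm.lintegral_prod_right'.aemeasurable]
  set κ := weightConst lam * Real.pi / (lam - 3) with hκ
  have key : ∀ a b, ∫⁻ q : ℂ × ℂ, density lam (mk ((a, b), q)) ≤
      (Metric.ball (0 : ℂ) 1).indicator (fun a =>
        (Metric.ball (0 : ℂ) (Real.sqrt (1 - ‖a‖ ^ 2))).indicator (fun _ =>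
          ENNReal.ofReal (κ / (1 - ‖a‖ ^ 2)) * NNReal.pi) b) a := by
    intro a b
    have hm' : Measurable fun q : ℂ × ℂ => density lam (mk ((a, b), q)) :=
      hm.comp measurable_prodMk_left
    rw [Measure.volume_eq_prod, lintegral_prod _ hm'.aemeasurable]
    refine (lintegral_mono fun c => lintegral_density_fst_le hlam a b c).trans ?_
    by_cases ha : a ∈ Metric.ball (0 : ℂ) 1
    · simp only [Set.indicator_of_mem ha]
      by_cases hb : b ∈ Metric.ball (0 : ℂ) (Real.sqrt (1 - ‖a‖ ^ 2))
      · simp only [Set.indicator_of_mem hb]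
        rw [lintegral_indicator Metric.isOpen_ball.measurableSet, setLIntegral_const,
          Complex.volume_ball, ENNReal.ofReal_one, one_pow, one_mul]
        refine le_of_eq ?_
        congr 2
        rw [hκ, div_div, mul_div_assoc, mul_comm (lam - 3)]
      · simp [Set.indicator_of_notMem hb]
    · simp [Set.indicator_of_notMem ha]
  have key2 : ∀ a, ∫⁻ b, ∫⁻ q : ℂ × ℂ, density lam (mk ((a, b), q)) ≤
      (Metric.ball (0 : ℂ) 1).indicator (fun _ =>
        ENNReal.ofReal κ * NNReal.pi * NNReal.pi) a := by
    intro a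
    refine (lintegral_mono fun b => key a b).trans ?_
    by_cases ha : a ∈ Metric.ball (0 : ℂ) 1
    · have hA : 0 < 1 - ‖a‖ ^ 2 := by
        rw [mem_ball_zero_iff] at ha
        nlinarith [norm_nonneg a]
      simp only [Set.indicator_of_mem ha]
      rw [lintegral_indicator Metric.isOpen_ball.measurableSet, setLIntegral_const,
        Complex.volume_ball, ← ENNReal.ofReal_pow (Real.sqrt_nonneg _), Real.sq_sqrt hA.le]
      refine le_of_eq ?_
      rw [mul_mul_mul_comm, ← ENNReal.ofReal_mul' hA.le, div_mul_cancel₀ _ hA.ne', mul_assoc]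
    · simp [Set.indicator_of_notMem ha]
  refine ((lintegral_mono key2).trans_lt ?_).ne
  rw [lintegral_indicator Metric.isOpen_ball.measurableSet, setLIntegral_const]
  exact ENNReal.mul_lt_top (ENNReal.mul_lt_top (ENNReal.mul_lt_top ENNReal.ofReal_lt_top
    ENNReal.coe_lt_top) ENNReal.coe_lt_top) Metric.isBounded_ball.measure_lt_top

theorem isFiniteMeasure_weightedMeasure {lam : ℝ} (hlam : 3 < lam) :
    IsFiniteMeasure (weightedMeasure lam) := by
  refine ⟨?_⟩
  rw [weightedMeasure, withDensity_apply _ MeasurableSet.univ, Measure.restrict_univ,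
    ← lintegral_indicator isOpen_domain.measurableSet]
  exact (lintegral_density_ne_top hlam).lt_top

/-! ### The algebra of torus-invariant symbols is not commutative -/

/-- The weight with which the torus acts on `Z ↦ Z₀₀ Z₁₁` and on `Z ↦ Z₀₁ Z₁₀`. -/
def torusChar (h : U2 × U2) : ℂ :=
  (h.1 : Matrix (Fin 2) (Fin 2) ℂ) 0 0 * (h.1 : Matrix (Fin 2) (Fin 2) ℂ) 1 1 *
    star ((h.2 : Matrix (Fin 2) (Fin 2) ℂ) 0 0 * (h.2 : Matrix (Fin 2) (Fin 2) ℂ) 1 1)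

/-- Functions on the domain that transform under the torus with the weight `torusChar`. -/
def HasTorusWeight (p : MatSpace → ℂ) : Prop :=
  ∀ h ∈ torus4, ∀ Z ∈ domain, p (act h Z) = torusChar h * p Z

theorem diagTorus_mul_star {t : U2} (ht : t ∈ diagTorus) (i : Fin 2) :
    (t : Matrix (Fin 2) (Fin 2) ℂ) i i * star ((t : Matrix (Fin 2) (Fin 2) ℂ) i i) = 1 := by
  have h := congrFun (congrFun (Matrix.mem_unitaryGroup_iff.1 t.2) i) i
  have ht' : (t : Matrix (Fin 2) (Fin 2) ℂ).IsDiag := ht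
  have h01 : (t : Matrix (Fin 2) (Fin 2) ℂ) 0 1 = 0 := ht' (by decide)
  have h10 : (t : Matrix (Fin 2) (Fin 2) ℂ) 1 0 = 0 := ht' (by decide)
  rw [Matrix.mul_apply, Fin.sum_univ_two, Matrix.one_apply_eq] at h
  fin_cases i <;> simpa [h01, h10] using h

theorem torusChar_mul_star {h : U2 × U2} (hh : h ∈ torus4) :
    torusChar h * star (torusChar h) = 1 := by
  have h1 := diagTorus_mul_star hh.1
  have h2 := diagTorus_mul_star hh.2
  have := congrArg₂ (· * ·) (congrArg₂ (· * ·) (h1 0) (h1 1)) (congrArg₂ (· * ·) (h2 0) (h2 1))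
  simp only [mul_one] at this
  rw [← this]
  simp only [torusChar, star_mul', star_star]
  ring

theorem act_torus_apply {h : U2 × U2} (hh : h ∈ torus4) (Z : MatSpace) (i j : Fin 2) :
    act h Z i j = (h.1 : Matrix (Fin 2) (Fin 2) ℂ) i i * Z i j *
      star ((h.2 : Matrix (Fin 2) (Fin 2) ℂ) j j) := by
  have h1 : (h.1 : Matrix (Fin 2) (Fin 2) ℂ).IsDiag := hh.1
  have h2 : (h.2 : Matrix (Fin 2) (Fin 2) ℂ).IsDiag := hh.2
  have a01 : (h.1 : Matrix (Fin 2) (Fin 2) ℂ) 0 1 = 0 := h1 (by decide)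
  have a10 : (h.1 : Matrix (Fin 2) (Fin 2) ℂ) 1 0 = 0 := h1 (by decide)
  have b01 : (h.2 : Matrix (Fin 2) (Fin 2) ℂ) 0 1 = 0 := h2 (by decide)
  have b10 : (h.2 : Matrix (Fin 2) (Fin 2) ℂ) 1 0 = 0 := h2 (by decide)
  change Matrix.of (act h Z) i j = _
  rw [act_apply, Matrix.mul_apply, Fin.sum_univ_two, Matrix.mul_apply, Matrix.mul_apply,
    Fin.sum_univ_two, Fin.sum_univ_two]
  fin_cases i <;> fin_cases j <;> simp [a01, a10, b01, b10]

theorem hasTorusWeight_diag : HasTorusWeight fun Z => Z 0 0 * Z 1 1 := by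
  intro h hh Z _
  simp only [act_torus_apply hh, torusChar, star_mul']
  ring

theorem hasTorusWeight_antidiag : HasTorusWeight fun Z => Z 0 1 * Z 1 0 := by
  intro h hh Z _
  simp only [act_torus_apply hh, torusChar, star_mul']
  ring

theorem act_mem_domain {Z : MatSpace} (hZ : Z ∈ domain) (h : U2 × U2) : act h Z ∈ domain :=
  ((isDomainSymmetry_act h).mem_iff Z).2 hZ

theorem HasTorusWeight.congr {p q : MatSpace → ℂ} (hp : HasTorusWeight p)
    (hpq : Set.EqOn q p domain) : HasTorusWeight q := fun h hh Z hZ => by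
  rw [hpq (act_mem_domain hZ h), hpq hZ, hp h hh Z hZ]

theorem HasTorusWeight.mem_invariantSymbols {p q : MatSpace → ℂ} (hp : HasTorusWeight p)
    (hq : HasTorusWeight q) (hpc : ContinuousOn p domain) (hqc : ContinuousOn q domain)
    {ρ : ℂ → ℝ} (hρ : Continuous ρ) (hρ1 : ∀ z, |ρ z| ≤ 1) :
    (fun Z => (ρ (star (p Z) * q Z) : ℂ)) ∈ invariantSymbols torus4 := by
  refine ⟨memLp_top_of_bound (C := 1) ?_ (Filter.Eventually.of_forall fun Z => ?_),
    fun h hh => ?_⟩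
  · refine ContinuousOn.aestronglyMeasurable ?_ isOpen_domain.measurableSet
    exact (Complex.continuous_ofReal.comp hρ).comp_continuousOn (hpc.star.mul hqc)
  · rw [Complex.norm_real]
    exact hρ1 _
  · filter_upwards [ae_restrict_mem isOpen_domain.measurableSet] with Z hZ
    rw [hp h hh Z hZ, hq h hh Z hZ, star_mul']
    congr 2
    linear_combination (star (p Z) * q Z) * torusChar_mul_star hh

/-- A bounded function with the same sign as `x`. -/
noncomputable def squash (x : ℝ) : ℝ := x / (1 + |x|)

theorem continuous_squash : Continuous squash := by
  refine continuous_id.div (by fun_prop) fun x => ?_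
  positivity

theorem abs_squash_le (x : ℝ) : |squash x| ≤ 1 := by
  rw [squash, abs_div, abs_of_pos (by positivity : 0 < 1 + |x|), div_le_one (by positivity)]
  linarith

theorem squash_mul_self_nonneg (x : ℝ) : 0 ≤ squash x * x := by
  rw [squash, div_mul_eq_mul_div]
  exact div_nonneg (mul_self_nonneg x) (by positivity)

theorem eq_zero_of_squash_mul_self {x : ℝ} (h : squash x * x = 0) : x = 0 := by
  rcases mul_eq_zero.1 h with h | h
  · rw [squash, div_eq_zero_iff] at h
    rcases h with h | h
    · exact h
    · have : 0 < 1 + |x| := by positivity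
      linarith
  · exact h

section
variable {lam : ℝ}

theorem eqOn_zero_of_integral_squash (hlam : 3 < lam) {m : MatSpace → ℝ}
    (hm : ContinuousOn m domain)
    (hint : Integrable (fun Z => squash (m Z) * m Z) (weightedMeasure lam))
    (h0 : ∫ Z, squash (m Z) * m Z ∂(weightedMeasure lam) = 0) : ∀ Z ∈ domain, m Z = 0 := by
  rw [integral_eq_zero_iff_of_nonneg (fun Z => squash_mul_self_nonneg _) hint] at h0
  have h1 := eqOn_of_ae_eq hlam ((continuous_squash.comp_continuousOn hm).mul hm)
    continuousOn_const h0
  exact fun Z hZ => eq_zero_of_squash_mul_self (h1 hZ)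

theorem integrable_toeplitz_integrand (u w : BergmanSpace lam) {φ : MatSpace → ℂ}
    (hφ : MemLp φ ∞ (volume.restrict domain)) :
    Integrable (fun Z => star (rep u Z) * (φ Z * rep w Z)) (weightedMeasure lam) := by
  have h1 : MemLp (fun Z => φ Z * rep w Z) 2 (weightedMeasure lam) :=
    (memLp_rep w).mul (memLp_weightedMeasure lam hφ)
  exact (memLp_rep u).star.integrable_mul h1

/-- Toeplitz operators with real symbols are symmetric. -/
theorem inner_toeplitz_left (u w : BergmanSpace lam) {ρ : MatSpace → ℝ}
    (hρ : MemLp (fun Z => (ρ Z : ℂ)) ∞ (volume.restrict domain)) :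
    inner ℂ (toeplitz lam _ hρ u) w = inner ℂ u (toeplitz lam _ hρ w) := by
  rw [← inner_conj_symm, inner_toeplitz, inner_toeplitz, ← integral_conj]
  congr 1
  ext Z
  simp only [map_mul, Complex.conj_ofReal, Complex.star_def, Complex.conj_conj]
  ring

theorem hasTorusWeight_rep_apply (hlam : 3 < lam)
    {T : BergmanSpace lam →L[ℂ] BergmanSpace lam} (hT : T ∈ toeplitzAlgebra lam torus4)
    {u : BergmanSpace lam} (hu : HasTorusWeight (rep u)) : HasTorusWeight (rep (T u)) := by
  intro h hh Z hZ
  have h1 : actUnitary hlam h u = torusChar h • u := ext_rep fun Z hZ => by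
    rw [actUnitary, rep_compUnitary hlam _ _ hZ, rep_smul hlam _ _ hZ]
    exact hu h hh Z hZ
  have h2 := apply_actUnitary hlam hT hh u
  rw [h1, map_smul] at h2
  have h3 := congrArg (fun v => rep v Z) h2
  simp only [actUnitary, rep_compUnitary hlam _ _ hZ, rep_smul hlam _ _ hZ] at h3
  exact h3.symm

/-- If `h` and `f` are holomorphic and `conj f * h` is real, then `h` is a multiple of `f`. -/
theorem exists_eq_smul_of_im_eq_zero (hlam : 3 < lam) {u w : BergmanSpace lam}
    (him : ∀ Z ∈ domain, (star (rep u Z) * rep w Z).im = 0) {W : MatSpace} (hW : W ∈ domain)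
    (hu : rep u W ≠ 0) : ∃ c : ℂ, w = c • u := by
  have hline : ∀ P Q : MatSpace, Differentiable ℂ fun t : ℂ => P + t • Q := fun P Q => by fun_prop
  have hrep : ∀ (v : BergmanSpace lam) (P Q : MatSpace) (s : ℂ), P + s • Q ∈ domain →
      DifferentiableAt ℂ (fun s => rep v (P + s • Q)) s := fun v P Q s hs =>
    ((differentiableOn_rep v).differentiableAt (isOpen_domain.mem_nhds hs)).comp s (hline P Q s)
  have hrep' : ∀ (v : BergmanSpace lam) (P Q : MatSpace) (s : ℂ), P + star s • Q ∈ domain →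
      DifferentiableAt ℂ (fun s => star (rep v (P + star s • Q))) s := fun v P Q s hs => by
    have := (hrep v P Q (star s) hs).star_star
    rwa [star_star] at this
  have hK := fun Z hZ => eq_zero_of_forall_diagonal
    (K := fun Z W => star (rep u W) * rep w Z - rep u Z * star (rep w W))
    (fun P Q t h1 h2 => ((hrep' u P Q t h2).mul (hrep w P Q t h1)).sub
      ((hrep u P Q t h1).mul (hrep' w P Q t h2)))
    (fun Z hZ => by
      have h1 : star (star (rep u Z) * rep w Z) = star (rep u Z) * rep w Z :=
        Complex.conj_eq_iff_im.2 (him Z hZ)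
      rw [star_mul', star_star] at h1
      exact sub_eq_zero.2 h1.symm) (Z := Z) (W := W) hZ hW
  have hu' : star (rep u W) ≠ 0 := by simpa using hu
  refine ⟨star (rep w W) / star (rep u W), ext_rep fun Z hZ => ?_⟩
  rw [rep_smul hlam _ _ hZ, Pi.smul_apply, smul_eq_mul, div_mul_eq_mul_div, eq_div_iff hu']
  linear_combination hK Z hZ

/-- If the algebra is commutative, vectors of the given weight are eigenvectors of all Toeplitz
operators with real symbols. -/
theorem exists_toeplitz_eq_smul (hlam : 3 < lam) (hcomm : IsCommutativeAlgebra lam torus4)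
    {u : BergmanSpace lam} (hu : HasTorusWeight (rep u)) {W : MatSpace} (hW : W ∈ domain)
    (hu0 : rep u W ≠ 0) {ρ : MatSpace → ℝ} (hρ : (fun Z => (ρ Z : ℂ)) ∈ invariantSymbols torus4) :
    ∃ c : ℂ, toeplitz lam _ hρ.1 u = c • u := by
  set S := toeplitz lam _ hρ.1 with hS
  have hSm : S ∈ toeplitzAlgebra lam torus4 := toeplitz_mem hρ
  have hw := hasTorusWeight_rep_apply hlam hSm hu
  have huc := (differentiableOn_rep u).continuousOn
  have hwc := (differentiableOn_rep (S u)).continuousOn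
  have hφ := hu.mem_invariantSymbols hw huc hwc (ρ := fun z => squash z.im)
    (continuous_squash.comp Complex.continuous_im) fun z => abs_squash_le _
  have hTm := toeplitz_mem (lam := lam) hφ
  have hreal : (inner ℂ u (toeplitz lam _ hφ.1 (S u))).im = 0 := by
    rw [← Complex.conj_eq_iff_im, inner_conj_symm, inner_toeplitz_left]
    refine (inner_toeplitz_left u _ hρ.1).trans ?_
    exact congrArg (fun A => inner ℂ u (A u)) (hcomm S hSm _ hTm)
  refine exists_eq_smul_of_im_eq_zero hlam ?_ hW hu0
  have hint := integrable_toeplitz_integrand u (S u) hφ.1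
  rw [inner_toeplitz] at hreal
  have him : ∀ Z, (star (rep u Z) * ((squash (star (rep u Z) * rep (S u) Z).im : ℂ) *
      rep (S u) Z)).im = squash (star (rep u Z) * rep (S u) Z).im *
        (star (rep u Z) * rep (S u) Z).im := fun Z => by
    rw [mul_left_comm, Complex.im_ofReal_mul]
  refine eqOn_zero_of_integral_squash hlam
    (Complex.continuous_im.comp_continuousOn (huc.star.mul hwc)) ?_ ?_
  · simp_rw [← him]
    exact hint.im
  · simp_rw [← him]
    exact (integral_im hint).trans hreal

theorem exists_eqOn_rep_of_norm_le (hlam : 3 < lam) {g : MatSpace → ℂ}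
    (hg : DifferentiableOn ℂ g domain) (h1 : ∀ Z ∈ domain, ‖g Z‖ ≤ 1) :
    ∃ u : BergmanSpace lam, Set.EqOn (rep u) g domain := by
  have := isFiniteMeasure_weightedMeasure hlam
  refine exists_eqOn_rep hlam hg (MemLp.of_bound ?_ 1 ?_)
  · exact (hg.continuousOn.aestronglyMeasurable isOpen_domain.measurableSet).mono_ac
      (weightedMeasure_absolutelyContinuous lam)
  · filter_upwards [ae_mem_domain lam] with Z hZ using h1 Z hZ

theorem not_isCommutativeAlgebra_torus4 (hlam : 3 < lam) : ¬ IsCommutativeAlgebra lam torus4 := by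
  intro hcomm
  have hmul : ∀ i j k l : Fin 2, ∀ Z ∈ domain, ‖Z i j * Z k l‖ ≤ 1 := fun i j k l Z hZ => by
    rw [norm_mul]
    exact mul_le_one₀ (norm_apply_lt_one hZ i j).le (norm_nonneg _) (norm_apply_lt_one hZ k l).le
  obtain ⟨F, hF⟩ := exists_eqOn_rep_of_norm_le hlam (g := fun Z => Z 0 0 * Z 1 1) (by fun_prop)
    (hmul 0 0 1 1)
  obtain ⟨G, hG⟩ := exists_eqOn_rep_of_norm_le hlam (g := fun Z => Z 0 1 * Z 1 0) (by fun_prop)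
    (hmul 0 1 1 0)
  set W : MatSpace := ![![1 / 2, 0], ![0, 1 / 2]] with hWdef
  set W' : MatSpace := ![![1 / 3, 1 / 3], ![1 / 3, 1 / 3]] with hWdef'
  have hW : W ∈ domain := by
    rw [mem_domain_iff_trace_gapDet, gap_trace_re, gapDet_eq]
    norm_num [hWdef, Complex.normSq_apply]
  have hW' : W' ∈ domain := by
    rw [mem_domain_iff_trace_gapDet, gap_trace_re, gapDet_eq]
    norm_num [hWdef', Complex.normSq_apply]
  have hFW : rep F W ≠ 0 := by
    rw [hF hW]; norm_num [hWdef]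
  have hF0 : F ≠ 0 := by
    rintro rfl
    refine hFW ?_
    have := rep_smul hlam (0 : ℂ) (0 : BergmanSpace lam) hW
    simpa using this
  have hFF : inner ℂ F F ≠ 0 := inner_self_ne_zero.2 hF0
  set α : ℂ := inner ℂ F G / inner ℂ F F with hα
  set u : BergmanSpace lam := G + (-α) • F with hu
  have huF : inner ℂ u F = 0 := by
    have : inner ℂ F u = 0 := by
      rw [hu, inner_add_right, inner_smul_right, hα]
      field_simp
      ring
    rw [← inner_conj_symm, this, map_zero]
  have hurep : ∀ Z ∈ domain, rep u Z = Z 0 1 * Z 1 0 - α * (Z 0 0 * Z 1 1) := fun Z hZ => by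
    rw [hu, rep_add hlam _ _ hZ, Pi.add_apply, rep_smul hlam _ _ hZ, Pi.smul_apply, hF hZ, hG hZ,
      smul_eq_mul]
    ring
  have hFw : HasTorusWeight (rep F) := hasTorusWeight_diag.congr hF
  have huw : HasTorusWeight (rep u) := by
    intro h hh Z hZ
    have h1 := hasTorusWeight_diag h hh Z hZ
    have h2 := hasTorusWeight_antidiag h hh Z hZ
    simp only at h1 h2
    rw [hurep _ (act_mem_domain hZ h), hurep Z hZ, h1, h2]
    ring
  have hFc := (differentiableOn_rep F).continuousOn
  have huc := (differentiableOn_rep u).continuousOn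
  have hψ := huw.mem_invariantSymbols hFw huc hFc (ρ := fun z => squash z.re)
    (continuous_squash.comp Complex.continuous_re) fun z => abs_squash_le _
  obtain ⟨c, hc⟩ := exists_toeplitz_eq_smul hlam hcomm hFw hW hFW hψ
  have hzero : (inner ℂ u (toeplitz lam _ hψ.1 F)).re = 0 := by
    rw [hc, inner_smul_right, huF, mul_zero, Complex.zero_re]
  rw [inner_toeplitz] at hzero
  have hint := integrable_toeplitz_integrand u F hψ.1
  have hre : ∀ Z, (star (rep u Z) * ((squash (star (rep u Z) * rep F Z).re : ℂ) *
      rep F Z)).re = squash (star (rep u Z) * rep F Z).re *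
        (star (rep u Z) * rep F Z).re := fun Z => by
    rw [mul_left_comm, Complex.re_ofReal_mul]
  have hall : ∀ Z ∈ domain, (star (rep u Z) * rep F Z).re = 0 := by
    refine eqOn_zero_of_integral_squash hlam
      (Complex.continuous_re.comp_continuousOn (huc.star.mul hFc)) ?_ ?_
    · simp_rw [← hre]
      exact hint.re
    · simp_rw [← hre]
      exact (integral_re hint).trans hzero
  have h1 := hall W hW
  have h2 := hall W' hW'
  rw [hurep W hW, hF hW] at h1
  rw [hurep W' hW', hF hW'] at h2
  norm_num [hWdef] at h1
  norm_num [hWdef', h1] at h2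

end

end MatrixBall

theorem mainTheorem1 (lam : ℝ) (hlam : 3 < lam) :
    MatrixBall.IsCommutativeAlgebra lam MatrixBall.unitaryTorus ∧
    (∀ H : Subgroup (MatrixBall.U2 × MatrixBall.U2),
      MatrixBall.torus4 ≤ H → IsConnected (H : Set (MatrixBall.U2 × MatrixBall.U2)) →
      MatrixBall.IsCommutativeAlgebra lam H →
        H = ⊤ ∨ H = MatrixBall.unitaryTorus ∨ H = MatrixBall.torusUnitary) ∧
    ∃ V : MatrixBall.BergmanSpace lam ≃ₗᵢ[ℂ] MatrixBall.BergmanSpace lam,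
      (fun T : MatrixBall.BergmanSpace lam →L[ℂ] MatrixBall.BergmanSpace lam =>
          (V : MatrixBall.BergmanSpace lam →L[ℂ] MatrixBall.BergmanSpace lam) ∘L T ∘L
            (V.symm : MatrixBall.BergmanSpace lam →L[ℂ] MatrixBall.BergmanSpace lam)) ''
        (MatrixBall.toeplitzAlgebra lam MatrixBall.unitaryTorus :
          Set (MatrixBall.BergmanSpace lam →L[ℂ] MatrixBall.BergmanSpace lam)) =
        (MatrixBall.toeplitzAlgebra lam MatrixBall.torusUnitary :
          Set (MatrixBall.BergmanSpace lam →L[ℂ] MatrixBall.BergmanSpace lam)) := by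
  refine ⟨MatrixBall.isCommutativeAlgebra_unitaryTorus hlam, fun H hT hconn hcomm => ?_,
    MatrixBall.transposeUnitary hlam, MatrixBall.transposeUnitary_image hlam⟩
  rcases MatrixBall.connected_subgroup_cases hT hconn with rfl | h
  · exact absurd hcomm (MatrixBall.not_isCommutativeAlgebra_torus4 hlam)
  · exact h
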